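/- All graphs are finite and simple, and graphs are identified up to isomorphism. The line graph $L(H)$ has the edges of $H$ as its vertices, two of them being adjacent when they are distinct and share an endpoint; $L^1(H)=L(H)$ and $L^{n}(H)=L(L^{n-1}(H))$ for $n\ge 2$. Let $K_4-e$ have vertices $0,1,2,3$ with $0,3$ non-adjacent, and define: \begin{itemize} \item $G_1=K_{1,3}$; $G_2$ is $K_4-e$ together with a vertex adjacent to exactly $0$ and $3$; $G_3=K_5-e$; \item $G_4$ is $K_4-e$ with one pendant vertex attached to $0$ and another attached to $3$; $G_5$ is obtained from $K_4$ by adding a vertex $x$ adjacent to exactly two vertices of $K_4$ and then a pendant vertex attached to $x$; $G_6$ consists of two copies of $K_4$ sharing exactly an edge; $G_7$ is $G_4$ with its two vertices of degree one joined by an edge; \item $G_8=P_6^2$ is the square of the path on six vertices; $G_9$ is the wheel with hub joined to all vertices of a $5$-cycle; \item $H_1=P_7^2$ is the square of the path on seven vertices; $H_2$ is $G_9$ with an additional vertex adjacent to exactly the two ends of one rim edge; $H_3$ is the graph on $\{0,\dots,7\}$ with exactly $15$ edges, namely those joining $6$ to the vertices of the $5$-cycle $0\,1\,5\,7\,4$,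 those of this cycle, those joining $7$ to the vertices of the $5$-cycle $2\,3\,5\,6\,4$, and those of this cycle. \end{itemize} (So $G_1,\dots,G_9$ are Beineke's nine minimal forbidden induced subgraphs for line graphs.) For $k\in\{1,2\}$ and $n\ge k$ let $L_{k,n}$ be the following graph: start with a path $v_1v_2\cdots v_n$; add a triangle $xuw$ and join $u$ and $w$ to $v_1$; if $k=2$, also add a second, disjoint triangle $x'u'w'$ and join $u'$ and $w'$ to $v_n$. A subgraph $K$ of a graph $G$ is called pendant if exactly one edge of $G$ joins a vertex of $K$ to a vertex outside $K$. Theorem. Let $G$ be a connected graph with maximum degree $\Delta(G)=4$ that is not isomorphic to any of $G_3,G_8,G_9,H_1,H_2,H_3$. Then: (a) $G=L(H)$ for some graph $H$ if and only if $G$ contains none of $G_1,G_2,G_4,G_5,G_6,G_7$ as an induced subgraph and does not contain $G_3$ as a pendant subgraph. (b) $G=L^3(H)$ for some graph $H$ if and only if $G\cong L(L_{k,n})$ for some $k\in\{1,2\}$ and $n\ge k$. (c) For every $n\ge 4$ and every graph $H$, $G\ne L^n(H)$. -/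

import Mathlib

universe u

namespace IterLine

/-- The iterated line graph, bundled with its vertex type:
`L^0(H) = H` and `L^(n+1)(H) = L(L^n(H))`. -/
def iterLineGraph {W : Type u} (H : SimpleGraph W) : ℕ → (Σ V : Type u, SimpleGraph V)
  | 0 => ⟨W, H⟩
  | n + 1 => ⟨(iterLineGraph H n).2.edgeSet, (iterLineGraph H n).2.lineGraph⟩

/-- `G = L(H)` (up to isomorphism) for some finite simple graph `H`. -/
def IsLineGraph {V : Type u} (G : SimpleGraph V) : Prop :=
  ∃ (W : Type u) (_ : Finite W) (H : SimpleGraph W), Nonempty (G ≃g H.lineGraph)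

/-- `G = L^n(H)` (up to isomorphism) for some finite simple graph `H`. -/
def IsIterLineGraph {V : Type u} (n : ℕ) (G : SimpleGraph V) : Prop :=
  ∃ (W : Type u) (_ : Finite W) (H : SimpleGraph W), Nonempty (G ≃g (iterLineGraph H n).2)

/-- A subgraph `K` of `G` is pendant if exactly one edge of `G` joins `K` to `G - K`. -/
def IsPendant {V : Type u} {G : SimpleGraph V} (K : G.Subgraph) : Prop :=
  ∃! e : Sym2 V, e ∈ G.edgeSet ∧ ∃ x ∈ K.verts, ∃ y ∉ K.verts, e = s(x, y)

/-- `G` contains a copy of `F` as a pendant subgraph. -/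
def ContainsPendant {V : Type u} {A : Type} (F : SimpleGraph A) (G : SimpleGraph V) : Prop :=
  ∃ K : G.Subgraph, Nonempty (F ≃g K.coe) ∧ IsPendant K

/-- The claw `K_{1,3}`. -/
def G1 : SimpleGraph (Fin 4) :=
  SimpleGraph.fromEdgeSet {s(0, 1), s(0, 2), s(0, 3)}

/-- `K_4 - e` on `0, 1, 2, 3` (with `0, 3` not adjacent) and a vertex `4` adjacent to `0, 3`. -/
def G2 : SimpleGraph (Fin 5) :=
  SimpleGraph.fromEdgeSet
    {s(0, 1), s(0, 2), s(1, 2), s(1, 3), s(2, 3), s(0, 4), s(3, 4)}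

/-- `K_5 - e`: the vertices `0, 4` are not adjacent. -/
def G3 : SimpleGraph (Fin 5) :=
  SimpleGraph.fromEdgeSet
    {s(0, 1), s(0, 2), s(0, 3), s(1, 2), s(1, 3), s(2, 3), s(1, 4), s(2, 4), s(3, 4)}

/-- `K_4 - e` on `0, 1, 2, 3` (with `0, 3` not adjacent), with a pendant vertex attached to each
of `0` and `3`. -/
def G4 : SimpleGraph (Fin 6) :=
  SimpleGraph.fromEdgeSet
    {s(0, 1), s(0, 2), s(1, 2), s(1, 3), s(2, 3), s(0, 4), s(3, 5)}

/-- `K_4` on `0, 1, 2, 3` and a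
vertex `4` adjacent to `2, 3`, together with a pendant vertex `5` attached to `4`. -/
def G5 : SimpleGraph (Fin 6) :=
  SimpleGraph.fromEdgeSet
    {s(0, 1), s(0, 2), s(0, 3), s(1, 2), s(1, 3), s(2, 3), s(2, 4), s(3, 4), s(4, 5)}

/-- Two copies of `K_4` sharing exactly the edge `2 3`. -/
def G6 : SimpleGraph (Fin 6) :=
  SimpleGraph.fromEdgeSet
    {s(0, 1), s(0, 2), s(0, 3), s(1, 2), s(1, 3), s(2, 3),
      s(2, 4), s(2, 5), s(3, 4), s(3, 5), s(4, 5)}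

/-- `G4` with its two vertices of degree one joined by an edge. -/
def G7 : SimpleGraph (Fin 6) :=
  SimpleGraph.fromEdgeSet
    {s(0, 1), s(0, 2), s(1, 2), s(1, 3), s(2, 3), s(0, 4), s(3, 5), s(4, 5)}

/-- The square of the path on six vertices. -/
def G8 : SimpleGraph (Fin 6) :=
  SimpleGraph.fromEdgeSet
    {s(0, 1), s(1, 2), s(2, 3), s(3, 4), s(4, 5), s(0, 2), s(1, 3), s(2, 4), s(3, 5)}

/-- The wheel with hub `5` and rim the five-cycle `0, 1, 2, 3, 4`. -/
def G9 : SimpleGraph (Fin 6) :=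
  SimpleGraph.fromEdgeSet
    {s(0, 1), s(1, 2), s(2, 3), s(3, 4), s(4, 0),
      s(5, 0), s(5, 1), s(5, 2), s(5, 3), s(5, 4)}

/-- The square of the path on seven vertices. -/
def H1 : SimpleGraph (Fin 7) :=
  SimpleGraph.fromEdgeSet
    {s(0, 1), s(1, 2), s(2, 3), s(3, 4), s(4, 5), s(5, 6),
      s(0, 2), s(1, 3), s(2, 4), s(3, 5), s(4, 6)}

/-- The wheel `G9` with a new vertex `6` adjacent to the two ends of the rim edge `0 1`. -/
def H2 : SimpleGraph (Fin 7) :=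
  SimpleGraph.fromEdgeSet
    {s(0, 1), s(1, 2), s(2, 3), s(3, 4), s(4, 0),
      s(5, 0), s(5, 1), s(5, 2), s(5, 3), s(5, 4), s(6, 0), s(6, 1)}

/-- Two overlapping wheels with five spokes: hub `6` with rim `0, 1, 5, 7, 4`, and hub `7` with
rim `2, 3, 5, 6, 4`. -/
def H3 : SimpleGraph (Fin 8) :=
  SimpleGraph.fromEdgeSet
    {s(6, 0), s(6, 1), s(6, 5), s(6, 7), s(6, 4), s(0, 1), s(1, 5), s(5, 7), s(7, 4), s(4, 0),
      s(7, 2), s(7, 3), s(2, 3), s(3, 5), s(4, 2)}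

/-- The edges of `L_{k,n}`, each listed in at least one direction (see `L`). -/
def LRel (k n : ℕ) : Fin n ⊕ (Fin k × Fin 3) → Fin n ⊕ (Fin k × Fin 3) → Prop
  | .inl i, .inl j => i.val + 1 = j.val
  | .inl i, .inr (p, t) => t ≠ 0 ∧ i.val = (if p.val = 0 then 0 else n - 1)
  | .inr _, .inl _ => False
  | .inr (p, _), .inr (q, _) => p = q

/-- The graph `L_{k,n}`, for `k = 1, 2` and `n ≥ k`: a path `v_0, …, v_{n-1}`, together with, for
each `p < k`, a triangle `(p, 0), (p, 1), (p, 2)` two of whose vertices, `(p, 1)` and `(p, 2)`,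
are joined to the end `v_0` (if `p = 0`) or `v_{n-1}` (if `p = 1`) of the path, thereby forming a
copy of `K_4 - e`. -/
def L (k n : ℕ) : SimpleGraph (Fin n ⊕ (Fin k × Fin 3)) :=
  SimpleGraph.fromRel (LRel k n)

end IterLine

namespace IterLine

/-! Part (a) rests on the van Rooij–Wilf criterion: line graphs are the claw-free graphs in which
two odd triangles sharing an edge always lie in a `K_4`. Necessity holds because an odd triangle of
a line graph can only come from a star. For sufficiency, odd triangles sort the neighbours of each
vertex into at most two cliques, which serve as the two ends of an edge (Krausz). This fails only
when two even triangles share an edge, and then the graph is an induced subgraph of the octahedron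
`L(K_4)`.

When no vertex has degree five, a bad pair of odd triangles produces one of `G1`, `G2`, `G3`, `G4`,
`G5`, `G7`, `G8`. Of these, `G3` and `G8` are excluded by a global argument: their inner vertices
are saturated, so a connected graph continues beyond them only at their ends. Hence `G3` is all of
`G` or pendant, and an induced `G8` leaves only `G8` and `H1` for `G`.

For (b) write `G = L(L(N))` with `N = L(H)` claw-free. A path `a b c` of `N` is a vertex of `G` of
degree `deg a + 2 deg b + deg c - 6`, so this sum is at most 10 before subtraction, with equality
somewhere. Thus `N` has a vertex of degree three, and each such vertex lies in a triangle whose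
other two vertices have degree two. Walking away from that triangle, one meets a leaf or a second
such triangle, so a component of `N` is some `T k n` (`exists_isComponentEmbedding_T`). Since `L k
n` is the line graph of `T k n`, and `T k n` that of `S k (n + 1)`, both directions of (b) follow.

For (c), `N` would moreover be the line graph of a claw-free graph. The end triangle of `T k n` is
odd, so it comes from a star. Claw-freeness joins two leaves of that star, and the new edge is an
extra neighbour of a vertex of degree two (`not_isComponentEmbedding_T_lineGraph`). -/

open SimpleGraph

/-! ### Line graphs from edge labels, and Krausz's criterion. -/

theorem nonempty_iso_lineGraph_of_labels {V I : Type*} (G : SimpleGraph V) (H : SimpleGraph I)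
    (f : V → Sym2 I) (hf : Function.Injective f) (hr : Set.range f = H.edgeSet)
    (hadj : ∀ x y, G.Adj x y ↔ x ≠ y ∧ ∃ i, i ∈ f x ∧ i ∈ f y) :
    Nonempty (G ≃g H.lineGraph) := by
  have hm : ∀ x, f x ∈ H.edgeSet := fun x => hr ▸ Set.mem_range_self x
  let e : V ≃ H.edgeSet := Equiv.ofBijective (fun x => ⟨f x, hm x⟩)
    ⟨fun x y h => hf (congrArg Subtype.val h), fun ⟨z, hz⟩ => by
      rw [← hr] at hz
      obtain ⟨x, rfl⟩ := hz
      exact ⟨x, rfl⟩⟩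
  refine ⟨⟨e, ?_⟩⟩
  intro x y
  have he : ∀ x, (e x : Sym2 I) = f x := fun _ => rfl
  rw [lineGraph_adj_iff_exists, hadj, Ne, e.injective.eq_iff, he, he]

theorem isLineGraph_of_labels {V I : Type u} [Finite I] (G : SimpleGraph V)
    (f : V → Sym2 I) (hf : Function.Injective f) (hd : ∀ x, ¬ (f x).IsDiag)
    (hadj : ∀ x y, G.Adj x y ↔ x ≠ y ∧ ∃ i, i ∈ f x ∧ i ∈ f y) : IsLineGraph G := by
  refine ⟨I, inferInstance, fromEdgeSet (Set.range f),
    nonempty_iso_lineGraph_of_labels G _ f hf ?_ hadj⟩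
  rw [edgeSet_fromEdgeSet]
  ext z
  simp only [Set.mem_sdiff, Set.mem_range]
  constructor
  · rintro ⟨x, rfl⟩
    exact ⟨⟨x, rfl⟩, hd x⟩
  · exact fun h => h.1

/-- Krausz's criterion, in terms of a set `T` of triangles such that the relation `T x` is
transitive on the neighbours of each `x` and has at most two classes there. -/
theorem isLineGraph_of_triangles {V : Type u} [Finite V] (G : SimpleGraph V)
    (T : V → V → V → Prop) (hadj : ∀ x y z, T x y z → G.Adj x y)
    (h12 : ∀ x y z, T x y z → T y x z) (h23 : ∀ x y z, T x y z → T x z y)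
    (htr : ∀ x y z w, T x y z → T x y w → z ≠ w → T x z w)
    (h3 : ∀ x a b c, G.Adj x a → G.Adj x b → G.Adj x c → a ≠ b → a ≠ c → b ≠ c →
      T x a b ∨ T x a c ∨ T x b c)
    (hnb : ∀ x, ∃ y, G.Adj x y) : IsLineGraph G := by
  -- The cell of the edge `x y`. Cells become the vertices of the root graph, which is why labels
  -- are taken in `Set V`.
  let K : V → V → Set V := fun x y => {z | z = x ∨ z = y ∨ T x y z}
  have Kmem : ∀ x y z, z ∈ K x y ↔ z = x ∨ z = y ∨ T x y z := fun _ _ _ => Iff.rfl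
  have Kcomm : ∀ x y, K x y = K y x := by
    intro x y
    ext z
    have := h12 x y z
    have := h12 y x z
    rw [Kmem, Kmem]
    tauto
  have Ksub : ∀ x y z, T x y z → K x y ⊆ K x z := by
    intro x y z h u hu
    rw [Kmem] at hu ⊢
    rcases hu with rfl | rfl | hu
    · exact Or.inl rfl
    · exact Or.inr (Or.inr (h23 _ _ _ h))
    · by_cases huz : u = z
      · exact Or.inr (Or.inl huz)
      · exact Or.inr (Or.inr (htr _ _ _ _ h hu (Ne.symm huz)))
  have Keq : ∀ x y z, T x y z → K x y = K x z := fun x y z h =>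
    (Ksub x y z h).antisymm (Ksub x z y (h23 _ _ _ h))
  have Kleft : ∀ x y z, z ∈ K x y → z ≠ x → K x z = K x y := by
    intro x y z hz hne
    rcases hz with rfl | rfl | hz
    · exact absurd rfl hne
    · rfl
    · exact (Keq _ _ _ hz).symm
  have Kadj : ∀ x y z, G.Adj x y → z ∈ K x y → z ≠ x → G.Adj x z := by
    intro x y z hxy hz hne
    rcases hz with rfl | rfl | hz
    · exact absurd rfl hne
    · exact hxy
    · exact hadj _ _ _ (h23 _ _ _ hz)
  -- The two cells at `x`. If there is only one, `{x}` is the second end, a leaf of the root graph;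
  -- it differs from `K x y₀`, which contains `y₀`.
  have pairs : ∀ x, ∃ A B : Set V, A ≠ B ∧ x ∈ A ∧ x ∈ B ∧
      (∀ y, G.Adj x y → K x y = A ∨ K x y = B) ∧
      (∀ C, C = A ∨ C = B → C = {x} ∨ ∃ y, G.Adj x y ∧ C = K x y) := by
    intro x
    obtain ⟨y₀, h₀⟩ := hnb x
    by_cases hall : ∀ y, G.Adj x y → K x y = K x y₀
    · refine ⟨K x y₀, {x}, ?_, Or.inl rfl, rfl, fun y hy => Or.inl (hall y hy), ?_⟩
      · intro h
        have : y₀ ∈ ({x} : Set V) := h ▸ (Or.inr (Or.inl rfl) : y₀ ∈ K x y₀)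
        exact h₀.ne (Set.mem_singleton_iff.1 this).symm
      · rintro C (rfl | rfl)
        · exact Or.inr ⟨y₀, h₀, rfl⟩
        · exact Or.inl rfl
    · push Not at hall
      obtain ⟨y₁, h₁, hne⟩ := hall
      refine ⟨K x y₀, K x y₁, hne.symm, Or.inl rfl, Or.inl rfl, ?_, ?_⟩
      · intro y hy
        by_contra hcon
        push Not at hcon
        have e01 : y₀ ≠ y₁ := fun h => hne (by rw [h])
        have e0 : y₀ ≠ y := fun h => hcon.1 (by rw [h])
        have e1 : y₁ ≠ y := fun h => hcon.2 (by rw [h])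
        rcases h3 x y₀ y₁ y h₀ h₁ hy e01 e0 e1 with h | h | h
        · exact hne (Keq _ _ _ h).symm
        · exact hcon.1 (Keq _ _ _ h).symm
        · exact hcon.2 (Keq _ _ _ h).symm
      · rintro C (rfl | rfl)
        · exact Or.inr ⟨y₀, h₀, rfl⟩
        · exact Or.inr ⟨y₁, h₁, rfl⟩
  choose A B hAB hxA hxB hcov hform using pairs
  have hself : ∀ x C, C ∈ s(A x, B x) → x ∈ C := by
    intro x C hC
    rcases Sym2.mem_iff.1 hC with rfl | rfl
    · exact hxA x
    · exact hxB x
  -- Distinct vertices can share only the cell `K x y`, and only if they are adjacent. Injectivity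
  -- and the adjacency condition both come from this.
  have hshare : ∀ x y C, x ≠ y → C ∈ s(A x, B x) → y ∈ C → C = K x y ∧ G.Adj x y := by
    intro x y C hne hC hy
    rcases hform x C (Sym2.mem_iff.1 hC) with rfl | ⟨p, hp, rfl⟩
    · exact absurd (Set.mem_singleton_iff.1 hy).symm hne
    · exact ⟨(Kleft _ _ _ hy hne.symm).symm, Kadj _ _ _ hp hy hne.symm⟩
  refine isLineGraph_of_labels (I := Set V) G (fun x => s(A x, B x)) ?_ ?_ ?_
  · intro x y hxy
    by_contra hne
    have hxy : s(A x, B x) = s(A y, B y) := hxy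
    have h1 := hshare x y (A x) hne (Sym2.mem_mk_left _ _)
      (hself y _ (hxy ▸ Sym2.mem_mk_left _ _))
    have h2 := hshare x y (B x) hne (Sym2.mem_mk_right _ _)
      (hself y _ (hxy ▸ Sym2.mem_mk_right _ _))
    exact hAB x (h1.1.trans h2.1.symm)
  · intro x
    simpa using hAB x
  · intro x y
    constructor
    · intro h
      refine ⟨h.ne, K x y, Sym2.mem_iff.2 ?_, Sym2.mem_iff.2 ?_⟩
      · exact hcov x y h
      · rw [Kcomm]
        exact hcov y x h.symm
    · rintro ⟨hne, C, hCx, hCy⟩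
      exact (hshare x y C hne hCx (hself y C hCy)).2

/-! ### Odd triangles and necessity of the van Rooij–Wilf conditions. -/

/-- `G` has no induced claw. -/
def ClawFree {V : Type*} (G : SimpleGraph V) : Prop :=
  ∀ a b c d, G.Adj a b → G.Adj a c → G.Adj a d → b ≠ c → b ≠ d → c ≠ d →
    G.Adj b c ∨ G.Adj b d ∨ G.Adj c d

/-- A triangle `x y z` such that some vertex is adjacent to an odd number of `x`, `y`, `z`. -/
def OddTriangle {V : Type*} (G : SimpleGraph V) (x y z : V) : Prop :=
  G.Adj x y ∧ G.Adj x z ∧ G.Adj y z ∧ ∃ v, (G.Adj v x ↔ (G.Adj v y ↔ G.Adj v z))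

/-- Two distinct odd triangles that share an edge always lie in a common `K_4`. -/
def OddDiamondFree {V : Type*} (G : SimpleGraph V) : Prop :=
  ∀ a b c d, OddTriangle G b c a → OddTriangle G b c d → a ≠ d → G.Adj a d

theorem ClawFree.of_embedding {V W : Type*} {F : SimpleGraph V} {G : SimpleGraph W}
    (h : ClawFree G) (f : F ↪g G) : ClawFree F := by
  intro a b c d hab hac had hbc hbd hcd
  simpa using h (f a) (f b) (f c) (f d) (by simpa) (by simpa) (by simpa) (by simpa) (by simpa)
    (by simpa)

theorem OddTriangle.map {V W : Type*} {F : SimpleGraph V} {G : SimpleGraph W} {x y z : V}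
    (h : OddTriangle F x y z) (f : F ↪g G) : OddTriangle G (f x) (f y) (f z) := by
  obtain ⟨h1, h2, h3, v, hv⟩ := h
  exact ⟨by simpa, by simpa, by simpa, f v, by simpa⟩

theorem OddDiamondFree.of_embedding {V W : Type*} {F : SimpleGraph V} {G : SimpleGraph W}
    (h : OddDiamondFree G) (f : F ↪g G) : OddDiamondFree F := by
  intro a b c d h1 h2 hne
  simpa using h _ _ _ _ (h1.map f) (h2.map f) (by simpa)

theorem clawFree_lineGraph {W : Type*} (H : SimpleGraph W) : ClawFree H.lineGraph := by
  rintro ⟨a, ha⟩ ⟨b, hb⟩ ⟨c, hc⟩ ⟨d, hd⟩ hab hac had hbc hbd hcd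
  rw [lineGraph_adj_iff_exists] at *
  simp only [lineGraph_adj_iff_exists]
  obtain ⟨-, x, hx, hx'⟩ := hab
  obtain ⟨-, y, hy, hy'⟩ := hac
  obtain ⟨-, z, hz, hz'⟩ := had
  induction a with | _ p q
  simp only [Sym2.mem_iff] at hx hy hz
  have : x = y ∨ x = z ∨ y = z := by
    rcases hx with rfl | rfl <;> rcases hy with rfl | rfl <;> rcases hz with rfl | rfl <;> simp
  rcases this with rfl | rfl | rfl
  · exact Or.inl ⟨hbc, x, hx', hy'⟩
  · exact Or.inr (Or.inl ⟨hbd, x, hx', hz'⟩)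
  · exact Or.inr (Or.inr ⟨hcd, y, hy', hz'⟩)

/-- Three pairwise meeting edges without a common vertex form a triangle of `H`. Every edge of `H`
is then adjacent to zero or two of its sides, a side being adjacent to the other two, so the parity
is always even. -/
theorem OddTriangle.exists_common {W : Type*} {H : SimpleGraph W} {a b c : H.edgeSet}
    (h : OddTriangle H.lineGraph a b c) :
    ∃ x, x ∈ (a : Sym2 W) ∧ x ∈ (b : Sym2 W) ∧ x ∈ (c : Sym2 W) := by
  obtain ⟨hab, hac, hbc, ⟨v, hvH⟩, hv⟩ := h
  obtain ⟨a, ha⟩ := a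
  obtain ⟨b, hb⟩ := b
  obtain ⟨c, hc⟩ := c
  simp only [lineGraph_adj_iff_exists, ne_eq, Subtype.mk.injEq] at *
  obtain ⟨hab, x, hx, hx'⟩ := hab
  obtain ⟨hac, y, hy, hy'⟩ := hac
  obtain ⟨hbc, z, hz, hz'⟩ := hbc
  by_cases hxy : x = y
  · exact ⟨x, hx, hx', hxy ▸ hy'⟩
  by_cases hxz : x = z
  · exact ⟨x, hx, hx', hxz ▸ hz'⟩
  by_cases hyz : y = z
  · exact ⟨y, hy, hyz ▸ hz, hy'⟩
  exfalso
  obtain rfl := (Sym2.mem_and_mem_iff hxy).1 ⟨hx, hy⟩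
  obtain rfl := (Sym2.mem_and_mem_iff hxz).1 ⟨hx', hz⟩
  obtain rfl := (Sym2.mem_and_mem_iff hyz).1 ⟨hy', hz'⟩
  induction v with | _ p q
  have hpq : p ≠ q := by simpa using H.ne_of_adj hvH
  have key : ∀ s t : W, (∃ i, i ∈ s(p, q) ∧ i ∈ s(s, t)) ↔ (p = s ∨ p = t ∨ q = s ∨ q = t) := by
    intro s t
    simp only [Sym2.mem_iff]
    constructor
    · rintro ⟨i, rfl | rfl, rfl | rfl⟩ <;> simp
    · rintro (rfl | rfl | rfl | rfl)
      exacts [⟨_, .inl rfl, .inl rfl⟩, ⟨_, .inl rfl, .inr rfl⟩, ⟨_, .inr rfl, .inl rfl⟩,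
        ⟨_, .inr rfl, .inr rfl⟩]
  simp only [key, Sym2.eq_iff] at hv
  grind

/-- Both triangles come from stars. The distinct edges `b` and `c` meet in one vertex only, so the
stars have the same centre, which lies on `a` and `d`. -/
theorem oddDiamondFree_lineGraph {W : Type*} (H : SimpleGraph W) :
    OddDiamondFree H.lineGraph := by
  intro a b c d h1 h2 hne
  have hbc := h1.1.ne
  obtain ⟨x, hxb, hxc, hxa⟩ := h1.exists_common
  obtain ⟨y, hyb, hyc, hyd⟩ := h2.exists_common
  rw [lineGraph_adj_iff_exists]
  refine ⟨hne, x, hxa, ?_⟩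
  by_cases hxy : x = y
  · exact hxy ▸ hyd
  · exact absurd (Subtype.ext (((Sym2.mem_and_mem_iff hxy).1 ⟨hxb, hyb⟩).trans
      ((Sym2.mem_and_mem_iff hxy).1 ⟨hxc, hyc⟩).symm)) hbc

theorem IsLineGraph.clawFree {V : Type u} {G : SimpleGraph V} (h : IsLineGraph G) :
    ClawFree G := by
  obtain ⟨W, _, H, ⟨e⟩⟩ := h
  exact (clawFree_lineGraph H).of_embedding e.toEmbedding

theorem IsLineGraph.oddDiamondFree {V : Type u} {G : SimpleGraph V} (h : IsLineGraph G) :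
    OddDiamondFree G := by
  obtain ⟨W, _, H, ⟨e⟩⟩ := h
  exact (oddDiamondFree_lineGraph H).of_embedding e.toEmbedding

theorem not_clawFree_G1 : ¬ ClawFree G1 := by
  intro h
  have := h 0 1 2 3
  simp [G1] at this

theorem not_oddDiamondFree_G2 : ¬ OddDiamondFree G2 := by
  intro h
  have := h 0 1 2 3 ⟨by simp [G2], by simp [G2], by simp [G2], 4, by simp [G2]⟩
    ⟨by simp [G2], by simp [G2], by simp [G2], 4, by simp [G2]⟩
  simp [G2] at this

theorem not_oddDiamondFree_G3 : ¬ OddDiamondFree G3 := by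
  intro h
  have := h 0 1 2 4 ⟨by simp [G3], by simp [G3], by simp [G3], 3, by simp [G3]⟩
    ⟨by simp [G3], by simp [G3], by simp [G3], 3, by simp [G3]⟩
  simp [G3] at this

theorem not_oddDiamondFree_G4 : ¬ OddDiamondFree G4 := by
  intro h
  have := h 0 1 2 3 ⟨by simp [G4], by simp [G4], by simp [G4], 4, by simp [G4]⟩
    ⟨by simp [G4], by simp [G4], by simp [G4], 5, by simp [G4]⟩
  simp [G4] at this

theorem not_oddDiamondFree_G5 : ¬ OddDiamondFree G5 := by
  intro h
  have := h 0 2 3 4 ⟨by simp [G5], by simp [G5], by simp [G5], 1, by simp [G5]⟩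
    ⟨by simp [G5], by simp [G5], by simp [G5], 5, by simp [G5]⟩
  simp [G5] at this

theorem not_oddDiamondFree_G6 : ¬ OddDiamondFree G6 := by
  intro h
  have := h 0 2 3 4 ⟨by simp [G6], by simp [G6], by simp [G6], 1, by simp [G6]⟩
    ⟨by simp [G6], by simp [G6], by simp [G6], 5, by simp [G6]⟩
  simp [G6] at this

theorem not_oddDiamondFree_G7 : ¬ OddDiamondFree G7 := by
  intro h
  have := h 0 1 2 3 ⟨by simp [G7], by simp [G7], by simp [G7], 4, by simp [G7]⟩
    ⟨by simp [G7], by simp [G7], by simp [G7], 5, by simp [G7]⟩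
  simp [G7] at this

/-! ### From forbidden induced subgraphs to odd triangles, in degree at most four. -/

theorem exists_embedding_of_lt {V : Type*} {G : SimpleGraph V} {n : ℕ} {F : SimpleGraph (Fin n)}
    (s : Fin n → V) (hne : ∀ i j, i < j → s i ≠ s j)
    (h : ∀ i j, i < j → (G.Adj (s i) (s j) ↔ F.Adj i j)) : ∃ f : F ↪g G, ∀ i, f i = s i := by
  refine ⟨⟨⟨s, fun i j hij => ?_⟩, ?_⟩, fun _ => rfl⟩
  · rcases lt_trichotomy i j with hlt | heq | hlt
    · exact absurd hij (hne i j hlt)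
    · exact heq
    · exact absurd hij.symm (hne j i hlt)
  · intro i j
    rcases lt_trichotomy i j with hlt | rfl | hlt
    · exact h i j hlt
    · simp
    · rw [G.adj_comm, F.adj_comm]
      exact h j i hlt

theorem isIndContained_of_lt {V : Type*} {G : SimpleGraph V} {n : ℕ} {F : SimpleGraph (Fin n)}
    (s : Fin n → V) (hne : ∀ i j, i < j → s i ≠ s j)
    (h : ∀ i j, i < j → (G.Adj (s i) (s j) ↔ F.Adj i j)) : F.IsIndContained G := by
  obtain ⟨f, -⟩ := exists_embedding_of_lt s hne h
  exact ⟨f⟩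

/-- No vertex has five distinct neighbours. -/
def DegreeLeFour {V : Type*} (G : SimpleGraph V) : Prop :=
  ∀ x a b c d e, G.Adj x a → G.Adj x b → G.Adj x c → G.Adj x d → G.Adj x e →
    a ≠ b → a ≠ c → a ≠ d → a ≠ e → b ≠ c → b ≠ d → b ≠ e → c ≠ d → c ≠ e → d ≠ e → False

theorem G1.isIndContained_of_adj {V : Type*} {G : SimpleGraph V} {a b c d : V}
    (hab : G.Adj a b) (hac : G.Adj a c) (had : G.Adj a d) (hbc : ¬ G.Adj b c)
    (hbd : ¬ G.Adj b d) (hcd : ¬ G.Adj c d) (nbc : b ≠ c) (nbd : b ≠ d) (ncd : c ≠ d) :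
    G1.IsIndContained G := by
  have := hab.ne
  have := hac.ne
  have := had.ne
  refine isIndContained_of_lt ![a, b, c, d] ?_ ?_ <;>
    simp [Fin.forall_fin_succ, G1, *]

theorem G2.isIndContained_of_adj {V : Type*} {G : SimpleGraph V} {a b c d e : V}
    (hab : G.Adj a b) (hac : G.Adj a c) (had : ¬ G.Adj a d) (hae : G.Adj a e) (hbc : G.Adj b
    c) (hbd : G.Adj b d) (hbe : ¬ G.Adj b e) (hcd : G.Adj c d) (hce : ¬ G.Adj c e)
    (hde : G.Adj d e) (nad : a ≠ d) (nbe : b ≠ e) (nce : c ≠ e) :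
    G2.IsIndContained G := by
  have := hab.ne
  have := hac.ne
  have := hae.ne
  have := hbc.ne
  have := hbd.ne
  have := hcd.ne
  have := hde.ne
  refine isIndContained_of_lt ![a, b, c, d, e] ?_ ?_ <;>
    simp [Fin.forall_fin_succ, G2, *]

theorem G3.isIndContained_of_adj {V : Type*} {G : SimpleGraph V} {a b c d e : V}
    (hab : G.Adj a b) (hac : G.Adj a c) (had : G.Adj a d) (hae : ¬ G.Adj a e) (hbc : G.Adj b
    c) (hbd : G.Adj b d) (hbe : G.Adj b e) (hcd : G.Adj c d) (hce : G.Adj c e)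
    (hde : G.Adj d e) (nae : a ≠ e) :
    G3.IsIndContained G := by
  have := hab.ne
  have := hac.ne
  have := had.ne
  have := hbc.ne
  have := hbd.ne
  have := hbe.ne
  have := hcd.ne
  have := hce.ne
  have := hde.ne
  refine isIndContained_of_lt ![a, b, c, d, e] ?_ ?_ <;>
    simp [Fin.forall_fin_succ, G3, *]

theorem G4.isIndContained_of_adj {V : Type*} {G : SimpleGraph V} {a b c d e f : V}
    (hab : G.Adj a b) (hac : G.Adj a c) (had : ¬ G.Adj a d) (hae : G.Adj a e)
    (haf : ¬ G.Adj a f) (hbc : G.Adj b c) (hbd : G.Adj b d) (hbe : ¬ G.Adj b e)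
    (hbf : ¬ G.Adj b f) (hcd : G.Adj c d) (hce : ¬ G.Adj c e) (hcf : ¬ G.Adj c f)
    (hde : ¬ G.Adj d e) (hdf : G.Adj d f) (hef : ¬ G.Adj e f) (nad : a ≠ d) (naf : a ≠ f)
    (nbe : b ≠ e) (nbf : b ≠ f) (nce : c ≠ e) (ncf : c ≠ f) (nde : d ≠ e) (nef : e ≠ f) :
    G4.IsIndContained G := by
  have := hab.ne
  have := hac.ne
  have := hae.ne
  have := hbc.ne
  have := hbd.ne
  have := hcd.ne
  have := hdf.ne
  refine isIndContained_of_lt ![a, b, c, d, e, f] ?_ ?_ <;>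
    simp [Fin.forall_fin_succ, G4, *]

theorem G5.isIndContained_of_adj {V : Type*} {G : SimpleGraph V} {a b c d e f : V}
    (hab : G.Adj a b) (hac : G.Adj a c) (had : G.Adj a d) (hae : ¬ G.Adj a e)
    (haf : ¬ G.Adj a f) (hbc : G.Adj b c) (hbd : G.Adj b d) (hbe : ¬ G.Adj b e)
    (hbf : ¬ G.Adj b f) (hcd : G.Adj c d) (hce : G.Adj c e) (hcf : ¬ G.Adj c f)
    (hde : G.Adj d e) (hdf : ¬ G.Adj d f) (hef : G.Adj e f) (nae : a ≠ e) (naf : a ≠ f)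
    (nbe : b ≠ e) (nbf : b ≠ f) (ncf : c ≠ f) (ndf : d ≠ f) :
    G5.IsIndContained G := by
  have := hab.ne
  have := hac.ne
  have := had.ne
  have := hbc.ne
  have := hbd.ne
  have := hcd.ne
  have := hce.ne
  have := hde.ne
  have := hef.ne
  refine isIndContained_of_lt ![a, b, c, d, e, f] ?_ ?_ <;>
    simp [Fin.forall_fin_succ, G5, *]

theorem G7.isIndContained_of_adj {V : Type*} {G : SimpleGraph V} {a b c d e f : V}
    (hab : G.Adj a b) (hac : G.Adj a c) (had : ¬ G.Adj a d) (hae : G.Adj a e)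
    (haf : ¬ G.Adj a f) (hbc : G.Adj b c) (hbd : G.Adj b d) (hbe : ¬ G.Adj b e)
    (hbf : ¬ G.Adj b f) (hcd : G.Adj c d) (hce : ¬ G.Adj c e) (hcf : ¬ G.Adj c f)
    (hde : ¬ G.Adj d e) (hdf : G.Adj d f) (hef : G.Adj e f) (nad : a ≠ d) (naf : a ≠ f)
    (nbe : b ≠ e) (nbf : b ≠ f) (nce : c ≠ e) (ncf : c ≠ f) (nde : d ≠ e) :
    G7.IsIndContained G := by
  have := hab.ne
  have := hac.ne
  have := hae.ne
  have := hbc.ne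
  have := hbd.ne
  have := hcd.ne
  have := hdf.ne
  have := hef.ne
  refine isIndContained_of_lt ![a, b, c, d, e, f] ?_ ?_ <;>
    simp [Fin.forall_fin_succ, G7, *]

theorem G8.isIndContained_of_adj {V : Type*} {G : SimpleGraph V} {a b c d e f : V}
    (hab : G.Adj a b) (hac : G.Adj a c) (had : ¬ G.Adj a d) (hae : ¬ G.Adj a e)
    (haf : ¬ G.Adj a f) (hbc : G.Adj b c) (hbd : G.Adj b d) (hbe : ¬ G.Adj b e)
    (hbf : ¬ G.Adj b f) (hcd : G.Adj c d) (hce : G.Adj c e) (hcf : ¬ G.Adj c f)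
    (hde : G.Adj d e) (hdf : G.Adj d f) (hef : G.Adj e f) (nad : a ≠ d) (nae : a ≠ e)
    (naf : a ≠ f) (nbe : b ≠ e) (nbf : b ≠ f) (ncf : c ≠ f) :
    G8.IsIndContained G := by
  have := hab.ne
  have := hac.ne
  have := hbc.ne
  have := hbd.ne
  have := hcd.ne
  have := hce.ne
  have := hde.ne
  have := hdf.ne
  have := hef.ne
  refine isIndContained_of_lt ![a, b, c, d, e, f] ?_ ?_ <;>
    simp [Fin.forall_fin_succ, G8, *]

/-- Let `v` and `w` witness oddness of the two triangles on `b c`, with `a`, `d` non-adjacent.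
Parity keeps `v` and `w` off `a, b, c, d`, and every adjacency pattern contradicts parity, creates a
vertex of degree five, or exhibits one of the seven graphs. `G6` and `G9` have a vertex of degree
five, so the degree bound stands in for them. -/
theorem oddDiamondFree_of_forbidden {V : Type*} {G : SimpleGraph V}
    (h₁ : ¬ G1.IsIndContained G) (h₂ : ¬ G2.IsIndContained G)
    (h₃ : ¬ G3.IsIndContained G) (h₄ : ¬ G4.IsIndContained G)
    (h₅ : ¬ G5.IsIndContained G) (h₇ : ¬ G7.IsIndContained G)
    (h₈ : ¬ G8.IsIndContained G) (hΔ : DegreeLeFour G) : OddDiamondFree G := by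
  rintro a b c d ⟨hbc, hab, hac, v, hv⟩ ⟨-, hbd, hcd, w, hw⟩ nad
  by_contra had
  replace hab := hab.symm
  replace hac := hac.symm
  replace hv : G.Adj a v ↔ (G.Adj b v ↔ G.Adj c v) := by
    simp only [G.adj_comm _ v]
    tauto
  replace hw : G.Adj b w ↔ (G.Adj c w ↔ G.Adj d w) := by
    simp only [G.adj_comm _ w]
    tauto
  have nbv : b ≠ v := by
    rintro rfl
    simp [hab, hbc.symm] at hv
  have ncv : c ≠ v := by
    rintro rfl
    simp [hac, hbc] at hv
  have nav : a ≠ v := by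
    rintro rfl
    simp [hab.symm, hac.symm] at hv
  have ndv : d ≠ v := by
    rintro rfl
    simp [had, hbd, hcd] at hv
  have nbw : b ≠ w := by
    rintro rfl
    simp [hbd.symm, hbc.symm] at hw
  have ncw : c ≠ w := by
    rintro rfl
    simp [hcd.symm, hbc] at hw
  have ndw : d ≠ w := by
    rintro rfl
    simp [hbd, hcd] at hw
  have naw : a ≠ w := by
    rintro rfl
    simp [mt Adj.symm had, hab.symm, hac.symm] at hw
  have nab := hab.ne
  have nac := hac.ne
  have nbc := hbc.ne
  have nbd := hbd.ne
  have ncd := hcd.ne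
  -- A common witness leaves only `G1`, `G2` and `G3`.
  rcases eq_or_ne v w with rfl | nvw
  · by_cases hav : G.Adj a v
    · by_cases hbv : G.Adj b v
      · by_cases hcv : G.Adj c v
        · by_cases hdv : G.Adj d v
          · exact absurd (G3.isIndContained_of_adj hab hac hav had hbc hbv hbd hcv hcd hdv.symm
              nad) h₃
          · exact absurd hw (by simp [hbv, hcv, hdv])
        · exact absurd hv (by simp [hav, hbv, hcv])
      · by_cases hcv : G.Adj c v
        · exact absurd hv (by simp [hav, hbv, hcv])
        · by_cases hdv : G.Adj d v
          · exact absurd (G2.isIndContained_of_adj hab hac had hav hbc hbd hbv hcd hcv hdv nad nbv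
              ncv) h₂
          · exact absurd hw (by simp [hbv, hcv, hdv])
    · by_cases hbv : G.Adj b v
      · by_cases hcv : G.Adj c v
        · exact absurd hv (by simp [hav, hbv, hcv])
        · by_cases hdv : G.Adj d v
          · exact absurd hw (by simp [hbv, hcv, hdv])
          · exact absurd (G1.isIndContained_of_adj hab.symm hbd hbv had hav hdv nad nav ndv) h₁
      · by_cases hcv : G.Adj c v
        · by_cases hdv : G.Adj d v
          · exact absurd hw (by simp [hbv, hcv, hdv])
          · exact absurd (G1.isIndContained_of_adj hac.symm hcd hcv had hav hdv nad nav ndv) h₁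
        · exact absurd hv (by simp [hav, hbv, hcv])
  · by_cases hbv : G.Adj b v
    · by_cases hbw : G.Adj b w
      · exact (hΔ b a c d v w hab.symm hbc hbd hbv hbw nac nad nav naw ncd ncv ncw ndv ndw nvw).elim
      · by_cases hav : G.Adj a v
        · by_cases hcv : G.Adj c v
          · by_cases hdv : G.Adj d v
            · exact absurd (G3.isIndContained_of_adj hab hac hav had hbc hbv hbd hcv hcd hdv.symm
                nad) h₃
            · by_cases hcw : G.Adj c w
              · exact (hΔ c a b d v w hac.symm hbc.symm hcd hcv hcw nab nad nav naw nbd nbv nbw ndv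
                  ndw nvw).elim
              · by_cases hdw : G.Adj d w
                · by_cases haw : G.Adj a w
                  · exact absurd (G2.isIndContained_of_adj hab hac had haw hbc hbd hbw hcd hcw hdw
                      nad nbw ncw) h₂
                  · by_cases hvw : G.Adj v w
                    · exact absurd (G2.isIndContained_of_adj hbd.symm hcd.symm hdv hdw hbc hbv hbw
                        hcv hcw hvw ndv nbw ncw) h₂
                    · exact absurd (G5.isIndContained_of_adj hav hab hac had haw hbv.symm hcv.symm
                        (mt Adj.symm hdv) hvw hbc hbd hbw hcd hcw hdw nad naw ndv.symm nvw nbw ncw)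
                        h₅
                · exact absurd hw (by simp [hbw, hcw, hdw])
          · exact absurd hv (by simp [hav, hbv, hcv])
        · by_cases hcv : G.Adj c v
          · exact absurd hv (by simp [hav, hbv, hcv])
          · by_cases hdv : G.Adj d v
            · by_cases hcw : G.Adj c w
              · by_cases hdw : G.Adj d w
                · exact absurd hw (by simp [hbw, hcw, hdw])
                · by_cases haw : G.Adj a w
                  · by_cases hvw : G.Adj v w
                    · exact absurd (G2.isIndContained_of_adj hab.symm hbc hbw hbv hac haw hav hcw
                        hcv hvw.symm nbw nav ncv) h₂
                    · exact absurd (G8.isIndContained_of_adj hdv.symm hbv.symm (mt Adj.symm hcv)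
                        (mt Adj.symm hav) hvw hbd.symm hcd.symm (mt Adj.symm had) hdw hbc hab.symm
                        hbw hac.symm hcw haw ncv.symm nav.symm nvw nad.symm ndw nbw) h₈
                  · exact absurd (G1.isIndContained_of_adj hac.symm hcd hcw had haw hdw nad naw
                      ndw) h₁
              · by_cases hdw : G.Adj d w
                · by_cases haw : G.Adj a w
                  · exact absurd (G2.isIndContained_of_adj hab hac had haw hbc hbd hbw hcd hcw hdw
                      nad nbw ncw) h₂
                  · by_cases hvw : G.Adj v w
                    · exact absurd (G8.isIndContained_of_adj hac hab had hav haw hbc.symm hcd hcv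
                        hcw hbd hbv hbw hdv hdw hvw nad nav naw ncv ncw nbw) h₈
                    · exact absurd (G1.isIndContained_of_adj hcd.symm hdv hdw hcv hcw hvw ncv ncw
                        nvw) h₁
                · exact absurd hw (by simp [hbw, hcw, hdw])
            · exact absurd (G1.isIndContained_of_adj hab.symm hbd hbv had hav hdv nad nav ndv) h₁
    · by_cases hav : G.Adj a v
      · by_cases hcv : G.Adj c v
        · exact absurd hv (by simp [hav, hbv, hcv])
        · by_cases hdv : G.Adj d v
          · exact absurd (G2.isIndContained_of_adj hab hac had hav hbc hbd hbv hcd hcv hdv nad nbv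
              ncv) h₂
          · by_cases hbw : G.Adj b w
            · by_cases hcw : G.Adj c w
              · by_cases hdw : G.Adj d w
                · by_cases haw : G.Adj a w
                  · exact absurd (G3.isIndContained_of_adj hab hac haw had hbc hbw hbd hcw hcd
                      hdw.symm nad) h₃
                  · by_cases hvw : G.Adj v w
                    · exact absurd (G2.isIndContained_of_adj hab hac haw hav hbc hbw hbv hcw hcv
                        hvw.symm naw nbv ncv) h₂
                    · exact absurd (G5.isIndContained_of_adj hdw hbd.symm hcd.symm (mt Adj.symm
                        had) hdv hbw.symm hcw.symm (mt Adj.symm haw) (mt Adj.symm hvw) hbc hab.symm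
                        hbv hac.symm hcv hav nad.symm ndv naw.symm nvw.symm nbv ncv) h₅
                · exact absurd hw (by simp [hbw, hcw, hdw])
              · by_cases hdw : G.Adj d w
                · exact absurd hw (by simp [hbw, hcw, hdw])
                · by_cases haw : G.Adj a w
                  · by_cases hvw : G.Adj v w
                    · exact absurd (G8.isIndContained_of_adj hcd.symm hbd.symm (mt Adj.symm had)
                        hdw hdv hbc.symm hac.symm hcw hcv hab.symm hbw hbv haw hav hvw.symm
                        nad.symm ndw ndv ncw ncv nbv) h₈
                    · exact absurd (G1.isIndContained_of_adj hac hav haw hcv hcw hvw ncv ncw nvw) h₁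
                  · exact absurd (G1.isIndContained_of_adj hab.symm hbd hbw had haw hdw nad naw
                      ndw) h₁
            · by_cases hcw : G.Adj c w
              · by_cases hdw : G.Adj d w
                · exact absurd hw (by simp [hbw, hcw, hdw])
                · by_cases haw : G.Adj a w
                  · by_cases hvw : G.Adj v w
                    · exact absurd (G8.isIndContained_of_adj hbd.symm hcd.symm (mt Adj.symm had)
                        hdw hdv hbc hab.symm hbw hbv hac.symm hcw hcv haw hav hvw.symm nad.symm ndw
                        ndv nbw nbv ncv) h₈
                    · exact absurd (G1.isIndContained_of_adj hab hav haw hbv hbw hvw nbv nbw nvw) h₁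
                  · exact absurd (G1.isIndContained_of_adj hac.symm hcd hcw had haw hdw nad naw
                      ndw) h₁
              · by_cases hdw : G.Adj d w
                · by_cases haw : G.Adj a w
                  · exact absurd (G2.isIndContained_of_adj hab hac had haw hbc hbd hbw hcd hcw hdw
                      nad nbw ncw) h₂
                  · by_cases hvw : G.Adj v w
                    · exact absurd (G7.isIndContained_of_adj hab hac had hav haw hbc hbd hbv hbw
                        hcd hcv hcw hdv hdw hvw nad naw nbv nbw ncv ncw ndv) h₇
                    · exact absurd (G4.isIndContained_of_adj hab hac had hav haw hbc hbd hbv hbw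
                        hcd hcv hcw hdv hdw hvw nad naw nbv nbw ncv ncw ndv nvw) h₄
                · exact absurd hw (by simp [hbw, hcw, hdw])
      · by_cases hcv : G.Adj c v
        · by_cases hdv : G.Adj d v
          · by_cases hcw : G.Adj c w
            · exact (hΔ c a b d v w hac.symm hbc.symm hcd hcv hcw nab nad nav naw nbd nbv nbw ndv
                ndw nvw).elim
            · by_cases hbw : G.Adj b w
              · by_cases hdw : G.Adj d w
                · exact absurd hw (by simp [hbw, hcw, hdw])
                · by_cases haw : G.Adj a w
                  · by_cases hvw : G.Adj v w
                    · exact absurd (G2.isIndContained_of_adj hbc hbd hbv hbw hcd hcv hcw hdv hdw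
                        hvw nbv ncw ndw) h₂
                    · exact absurd (G8.isIndContained_of_adj hdv.symm hcv.symm (mt Adj.symm hbv)
                        (mt Adj.symm hav) hvw hcd.symm hbd.symm (mt Adj.symm had) hdw hbc.symm
                        hac.symm hcw hab.symm hbw haw nbv.symm nav.symm nvw nad.symm ndw ncw) h₈
                  · exact absurd (G1.isIndContained_of_adj hab.symm hbd hbw had haw hdw nad naw
                      ndw) h₁
              · by_cases hdw : G.Adj d w
                · by_cases haw : G.Adj a w
                  · exact absurd (G2.isIndContained_of_adj hab hac had haw hbc hbd hbw hcd hcw hdw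
                      nad nbw ncw) h₂
                  · by_cases hvw : G.Adj v w
                    · exact absurd (G8.isIndContained_of_adj hab hac had hav haw hbc hbd hbv hbw
                        hcd hcv hcw hdv hdw hvw nad nav naw nbv nbw ncw) h₈
                    · exact absurd (G1.isIndContained_of_adj hbd.symm hdv hdw hbv hbw hvw nbv nbw
                        nvw) h₁
                · exact absurd hw (by simp [hbw, hcw, hdw])
          · exact absurd (G1.isIndContained_of_adj hac.symm hcd hcv had hav hdv nad nav ndv) h₁
        · exact absurd hv (by simp [hav, hbv, hcv])

/-! ### Excluding `P_6^2` and `K_5 - e` by connectedness. -/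

/-- The ways in which a further vertex can be attached to an induced `P_6^2`. -/
theorem adj_cases_of_G8 {V : Type*} {G : SimpleGraph V}
    (h₁ : ¬ G1.IsIndContained G) (h₂ : ¬ G2.IsIndContained G)
    (h₄ : ¬ G4.IsIndContained G) (h₇ : ¬ G7.IsIndContained G) (hΔ : DegreeLeFour G)
    (g : G8 ↪g G) (x : V) (hx : ∀ i, g i ≠ x) :
    (∀ i, ¬ G.Adj (g i) x) ∨ (∀ i, G.Adj (g i) x ↔ i = 0 ∨ i = 1) ∨
      (∀ i, G.Adj (g i) x ↔ i = 4 ∨ i = 5) := by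
  obtain ⟨a, ha⟩ : ∃ a, a = g 0 := ⟨_, rfl⟩
  obtain ⟨b, hb⟩ : ∃ b, b = g 1 := ⟨_, rfl⟩
  obtain ⟨c, hc⟩ : ∃ c, c = g 2 := ⟨_, rfl⟩
  obtain ⟨d, hd⟩ : ∃ d, d = g 3 := ⟨_, rfl⟩
  obtain ⟨e, he⟩ : ∃ e, e = g 4 := ⟨_, rfl⟩
  obtain ⟨f, hf⟩ : ∃ f, f = g 5 := ⟨_, rfl⟩
  have nax : a ≠ x := ha ▸ hx 0
  have nbx : b ≠ x := hb ▸ hx 1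
  have ncx : c ≠ x := hc ▸ hx 2
  have ndx : d ≠ x := hd ▸ hx 3
  have nex : e ≠ x := he ▸ hx 4
  have nfx : f ≠ x := hf ▸ hx 5
  have hab : G.Adj a b := by
    rw [ha, hb, g.map_adj_iff]
    simp [G8]
  have hac : G.Adj a c := by
    rw [ha, hc, g.map_adj_iff]
    simp [G8]
  have had : ¬ G.Adj a d := by
    rw [ha, hd, g.map_adj_iff]
    simp [G8]
  have hae : ¬ G.Adj a e := by
    rw [ha, he, g.map_adj_iff]
    simp [G8]
  have haf : ¬ G.Adj a f := by
    rw [ha, hf, g.map_adj_iff]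
    simp [G8]
  have hbc : G.Adj b c := by
    rw [hb, hc, g.map_adj_iff]
    simp [G8]
  have hbd : G.Adj b d := by
    rw [hb, hd, g.map_adj_iff]
    simp [G8]
  have hbe : ¬ G.Adj b e := by
    rw [hb, he, g.map_adj_iff]
    simp [G8]
  have hbf : ¬ G.Adj b f := by
    rw [hb, hf, g.map_adj_iff]
    simp [G8]
  have hcd : G.Adj c d := by
    rw [hc, hd, g.map_adj_iff]
    simp [G8]
  have hce : G.Adj c e := by
    rw [hc, he, g.map_adj_iff]
    simp [G8]
  have hcf : ¬ G.Adj c f := by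
    rw [hc, hf, g.map_adj_iff]
    simp [G8]
  have hde : G.Adj d e := by
    rw [hd, he, g.map_adj_iff]
    simp [G8]
  have hdf : G.Adj d f := by
    rw [hd, hf, g.map_adj_iff]
    simp [G8]
  have hef : G.Adj e f := by
    rw [he, hf, g.map_adj_iff]
    simp [G8]
  have nab : a ≠ b := by simp [ha, hb]
  have nac : a ≠ c := by simp [ha, hc]
  have nad : a ≠ d := by simp [ha, hd]
  have nae : a ≠ e := by simp [ha, he]
  have naf : a ≠ f := by simp [ha, hf]
  have nbc : b ≠ c := by simp [hb, hc]
  have nbd : b ≠ d := by simp [hb, hd]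
  have nbe : b ≠ e := by simp [hb, he]
  have nbf : b ≠ f := by simp [hb, hf]
  have ncd : c ≠ d := by simp [hc, hd]
  have nce : c ≠ e := by simp [hc, he]
  have ncf : c ≠ f := by simp [hc, hf]
  have nde : d ≠ e := by simp [hd, he]
  have ndf : d ≠ f := by simp [hd, hf]
  have nef : e ≠ f := by simp [he, hf]
  simp only [Fin.forall_fin_succ, Fin.forall_fin_zero]
  simp only [Fin.isValue, Fin.reduceSucc, ← ha, ← hb, ← hc, ← hd, ← he, ← hf]
  suffices (¬ G.Adj a x ∧ ¬ G.Adj b x ∧ ¬ G.Adj c x ∧ ¬ G.Adj d x ∧ ¬ G.Adj e x ∧ ¬ G.Adj f x) ∨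
      (G.Adj a x ∧ G.Adj b x ∧ ¬ G.Adj c x ∧ ¬ G.Adj d x ∧ ¬ G.Adj e x ∧ ¬ G.Adj f x) ∨
      (¬ G.Adj a x ∧ ¬ G.Adj b x ∧ ¬ G.Adj c x ∧ ¬ G.Adj d x ∧ G.Adj e x ∧ G.Adj f x) by
    simpa using this
  -- The middle vertices `c` and `d` already have four neighbours inside the copy.
  by_cases hcx : G.Adj c x
  · exact (hΔ c a b d e x hac.symm hbc.symm hcd hce hcx nab nad nae nax nbd nbe nbx nde ndx
      nex).elim
  · by_cases hdx : G.Adj d x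
    · exact (hΔ d b c e f x hbd.symm hcd.symm hde hdf hdx nbc nbe nbf nbx nce ncf ncx nef nex
        nfx).elim
    · by_cases hax : G.Adj a x
      · by_cases hbx : G.Adj b x
        · by_cases hex : G.Adj e x
          · exact absurd (G2.isIndContained_of_adj hbc hbd hbe hbx hcd hce hcx hde hdx hex nbe ncx
              ndx) h₂
          · by_cases hfx : G.Adj f x
            · exact absurd (G7.isIndContained_of_adj hac.symm hbc.symm hcx hce hcf hab hax hae haf
                hbx hbe hbf (mt Adj.symm hex) hfx.symm hef ncx ncf nae naf nbe nbf nex.symm) h₇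
            · exact Or.inr (Or.inl ⟨hax, hbx, hcx, hdx, hex, hfx⟩)
        · by_cases hfx : G.Adj f x
          · exact absurd (G7.isIndContained_of_adj hab hac had hax haf hbc hbd hbx hbf hcd hcx hcf
              hdx hdf hfx.symm nad naf nbx nbf ncx ncf ndx) h₇
          · exact absurd (G4.isIndContained_of_adj hab hac had hax haf hbc hbd hbx hbf hcd hcx hcf
              hdx hdf (mt Adj.symm hfx) nad naf nbx nbf ncx ncf ndx nfx.symm) h₄
      · by_cases hbx : G.Adj b x
        · exact absurd (G1.isIndContained_of_adj hab.symm hbd hbx had hax hdx nad nax ndx) h₁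
        · by_cases hex : G.Adj e x
          · by_cases hfx : G.Adj f x
            · exact Or.inr (Or.inr ⟨hax, hbx, hcx, hdx, hex, hfx⟩)
            · exact absurd (G1.isIndContained_of_adj hce.symm hef hex hcf hcx hfx ncf ncx nfx) h₁
          · by_cases hfx : G.Adj f x
            · exact absurd (G4.isIndContained_of_adj hcd hce hcf hac.symm hcx hde hdf (mt Adj.symm
                had) hdx hef (mt Adj.symm hae) hex (mt Adj.symm haf) hfx hax ncf ncx nad.symm ndx
                nae.symm nex naf.symm nax) h₄
            · exact Or.inl ⟨hax, hbx, hcx, hdx, hex, hfx⟩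

theorem exists_adj_boundary {V : Type*} {G : SimpleGraph V} (hconn : G.Connected) {S : Set V}
    {a b : V} (ha : a ∈ S) (hb : b ∉ S) : ∃ x ∈ S, ∃ y ∉ S, G.Adj x y := by
  obtain ⟨p⟩ := hconn.preconnected a b
  obtain ⟨d, -, h1, h2⟩ := p.exists_boundary_dart S ha hb
  exact ⟨d.fst, h1, d.snd, h2, d.adj⟩

theorem exists_adj_of_embedding {V A : Type*} {G : SimpleGraph V} (hconn : G.Connected)
    {F : SimpleGraph A} [Nonempty A] (hF : IsEmpty (G ≃g F)) (g : F ↪g G) :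
    ∃ i x, (∀ j, g j ≠ x) ∧ G.Adj (g i) x := by
  have hs : ¬ Function.Surjective g := fun hs => hF.elim (RelIso.ofSurjective g hs).symm
  simp only [Function.Surjective, not_forall] at hs
  obtain ⟨b, hb⟩ := hs
  obtain ⟨_, ⟨i, rfl⟩, x, hx, hadj⟩ := exists_adj_boundary hconn (S := Set.range g)
    (Set.mem_range_self (Classical.arbitrary A)) hb
  exact ⟨i, x, fun j hj => hx ⟨j, hj⟩, hadj⟩

/-- A proper induced `P_6^2` in a connected graph has a further vertex attached, necessarily at an
end, which extends it to `P_7^2`. Nothing can be attached to `P_7^2` in turn, so `G` would be `H1`.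
-/
theorem not_isIndContained_G8 {V : Type*} {G : SimpleGraph V} (hconn : G.Connected)
    (h₁ : ¬ G1.IsIndContained G) (h₂ : ¬ G2.IsIndContained G)
    (h₄ : ¬ G4.IsIndContained G) (h₇ : ¬ G7.IsIndContained G) (hΔ : DegreeLeFour G)
    (hG8 : IsEmpty (G ≃g G8)) (hH1 : IsEmpty (G ≃g H1)) : ¬ G8.IsIndContained G := by
  have key : ∀ (g : G8 ↪g G) (x : V), (∀ i, g i ≠ x) →
      ¬ (∀ i, G.Adj (g i) x ↔ i = 0 ∨ i = 1) := by
    intro g x hx hadj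
    obtain ⟨f, hf⟩ : ∃ f : H1 ↪g G, ∀ i, f i = (Fin.cons x g : Fin 7 → V) i := by
      refine exists_embedding_of_lt _ ?_ ?_
      · intro i j
        induction i using Fin.cases with
        | zero =>
          induction j using Fin.cases with
          | zero => simp
          | succ j => exact fun _ => (hx j).symm
        | succ i =>
          induction j using Fin.cases with
          | zero => simp
          | succ j =>
            intro hij
            simpa using (Fin.succ_lt_succ_iff.1 hij).ne
      · intro i j
        induction i using Fin.cases with
        | zero =>
          induction j using Fin.cases with
          | zero => simp
          | succ j =>
            intro _
            rw [Fin.cons_zero, Fin.cons_succ, G.adj_comm, hadj]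
            revert j
            simp [Fin.forall_fin_succ, H1]
        | succ i =>
          induction j using Fin.cases with
          | zero => simp
          | succ j =>
            intro _
            rw [Fin.cons_succ, Fin.cons_succ, g.map_adj_iff]
            revert i j
            simp [Fin.forall_fin_succ, H1, G8]
    obtain ⟨i, y, hy, hiy⟩ := exists_adj_of_embedding hconn hH1 f
    -- The new vertex must fit both copies of `P_6^2` in `P_7^2`. One copy allows the pairs `{0, 1}`
    -- and `{4, 5}`, the other `{1, 2}` and `{5, 6}`; these are incompatible, so the vertex has no
    -- neighbour in `P_7^2`.
    obtain ⟨k₁, hk₁⟩ : ∃ k : G8 ↪g H1, ∀ i, k i = (![0, 1, 2, 3, 4, 5] : Fin 6 → Fin 7) i := by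
      refine exists_embedding_of_lt _ ?_ ?_ <;> simp [Fin.forall_fin_succ, H1, G8]
    obtain ⟨k₂, hk₂⟩ : ∃ k : G8 ↪g H1, ∀ i, k i = (![1, 2, 3, 4, 5, 6] : Fin 6 → Fin 7) i := by
      refine exists_embedding_of_lt _ ?_ ?_ <;> simp [Fin.forall_fin_succ, H1, G8]
    have c₁ := adj_cases_of_G8 h₁ h₂ h₄ h₇ hΔ (k₁.trans f) y (fun i => hy _)
    have c₂ := adj_cases_of_G8 h₁ h₂ h₄ h₇ hΔ (k₂.trans f) y (fun i => hy _)
    simp only [RelEmbedding.coe_trans, Function.comp_apply, hk₁, hk₂] at c₁ c₂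
    simp [Fin.forall_fin_succ] at c₁ c₂
    have hor : G.Adj (f 0) y ∨ G.Adj (f 1) y ∨ G.Adj (f 2) y ∨ G.Adj (f 3) y ∨ G.Adj (f 4) y ∨
        G.Adj (f 5) y ∨ G.Adj (f 6) y := by
      revert i
      simp only [Fin.forall_fin_succ]
      simp
      tauto
    tauto
  rintro ⟨g⟩
  obtain ⟨i, x, hx, hix⟩ := exists_adj_of_embedding hconn hG8 g
  rcases adj_cases_of_G8 h₁ h₂ h₄ h₇ hΔ g x hx with h | h | h
  · exact h i hix
  · exact key g x hx h
  -- Reversing the path exchanges its two ends.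
  · obtain ⟨k, hk⟩ : ∃ k : G8 ↪g G8, ∀ i, k i = (![5, 4, 3, 2, 1, 0] : Fin 6 → Fin 6) i := by
      refine exists_embedding_of_lt _ ?_ ?_ <;> simp [Fin.forall_fin_succ, G8]
    refine key (k.trans g) x (fun i => hx _) ?_
    simp only [RelEmbedding.coe_trans, Function.comp_apply, hk, h]
    simp [Fin.forall_fin_succ]

/-- Vertices `1, 2, 3` of `K_5 - e` are saturated, so the rest of `G` is attached at `0` and `4`
only. A common outside neighbour of these gives `G2`, and separate ones give `G4` or `G7`. Hence
only one of them is used; it has three neighbours inside, so just one outside, and the copy is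
pendant. -/
theorem not_isIndContained_G3 {V : Type*} {G : SimpleGraph V} (hconn : G.Connected)
    (h₂ : ¬ G2.IsIndContained G) (h₄ : ¬ G4.IsIndContained G) (h₇ : ¬ G7.IsIndContained G)
    (hp : ¬ ContainsPendant G3 G) (hΔ : DegreeLeFour G)
    (hG3 : IsEmpty (G ≃g G3)) : ¬ G3.IsIndContained G := by
  have outer : ∀ (g : G3 ↪g G) (x : V), (∀ i, g i ≠ x) → ∀ i, G.Adj (g i) x → i = 0 ∨ i = 4 := by
    intro g x hx i hix
    by_contra hi
    have full : ∀ j, j ≠ i → G.Adj (g i) (g j) := by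
      intro j hj
      rw [g.map_adj_iff]
      revert i j
      simp [Fin.forall_fin_succ, G3]
    have h5 : ∃ p q r s : Fin 5, p ≠ i ∧ q ≠ i ∧ r ≠ i ∧ s ≠ i ∧ p ≠ q ∧ p ≠ r ∧ p ≠ s ∧ q ≠ r ∧
        q ≠ s ∧ r ≠ s := by
      clear hi hix full
      revert i
      decide
    obtain ⟨p, q, r, s, hp, hq, hr, hs, hpq, hpr, hps, hqr, hqs, hrs⟩ := h5
    exact hΔ (g i) (g p) (g q) (g r) (g s) x (full p hp) (full q hq) (full r hr) (full s hs) hix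
      (by simpa) (by simpa) (by simpa) (hx p) (by simpa) (by simpa) (hx q) (by simpa) (hx r) (hx s)
  have edges : ∀ (g : G3 ↪g G), G.Adj (g 0) (g 1) ∧ G.Adj (g 0) (g 2) ∧ G.Adj (g 0) (g 3) ∧
      G.Adj (g 1) (g 2) ∧ G.Adj (g 1) (g 4) ∧ G.Adj (g 2) (g 4) ∧ ¬ G.Adj (g 0) (g 4) := by
    intro g
    simp only [g.map_adj_iff]
    simp [G3]
  have one : ∀ (g : G3 ↪g G) (x : V), (∀ i, g i ≠ x) → G.Adj (g 0) x → ¬ G.Adj (g 4) x := by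
    intro g x hx h0 h4'
    obtain ⟨e01, e02, e03, e12, e14, e24, e04⟩ := edges g
    have e1 : ¬ G.Adj (g 1) x := fun h => by simpa using outer g x hx 1 h
    have e2 : ¬ G.Adj (g 2) x := fun h => by simpa using outer g x hx 2 h
    exact h₂ (G2.isIndContained_of_adj e01 e02 e04 h0 e12 e14 e1 e24 e2 h4' (by simp)
      (hx 1) (hx 2))
  have two : ∀ (g : G3 ↪g G) (x y : V), (∀ i, g i ≠ x) → (∀ i, g i ≠ y) → G.Adj (g 0) x →
      ¬ G.Adj (g 4) y := by
    intro g x y hx hy h0 h4'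
    obtain ⟨e01, e02, e03, e12, e14, e24, e04⟩ := edges g
    have e1 : ¬ G.Adj (g 1) x := fun h => by simpa using outer g x hx 1 h
    have e2 : ¬ G.Adj (g 2) x := fun h => by simpa using outer g x hx 2 h
    have e4 := one g x hx h0
    have d1 : ¬ G.Adj (g 1) y := fun h => by simpa using outer g y hy 1 h
    have d2 : ¬ G.Adj (g 2) y := fun h => by simpa using outer g y hy 2 h
    have d0 : ¬ G.Adj (g 0) y := fun h => one g y hy h h4'
    have hxy : x ≠ y := fun h => e4 (h ▸ h4')
    by_cases hadj : G.Adj x y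
    · exact h₇ (G7.isIndContained_of_adj e01 e02 e04 h0 d0 e12 e14 e1 d1 e24 e2 d2 e4 h4' hadj
        (by simp) (hy 0) (hx 1) (hy 1) (hx 2) (hy 2) (hx 4))
    · exact h₄ (G4.isIndContained_of_adj e01 e02 e04 h0 d0 e12 e14 e1 d1 e24 e2 d2 e4 h4' hadj
        (by simp) (hy 0) (hx 1) (hy 1) (hx 2) (hy 2) (hx 4) hxy)
  have pend : ∀ (g : G3 ↪g G) (x : V), (∀ i, g i ≠ x) → ¬ G.Adj (g 0) x := by
    intro g x hx h0
    obtain ⟨e01, e02, e03, e12, e14, e24, e04⟩ := edges g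
    refine hp ⟨(⊤ : G.Subgraph).induce (Set.range g), ⟨⟨Equiv.ofInjective g g.injective, ?_⟩⟩, ?_⟩
    · intro i j
      change ((⊤ : G.Subgraph).induce (Set.range g)).Adj (g i) (g j) ↔ G3.Adj i j
      simp
    · refine ⟨s(g 0, x), ⟨h0, g 0, ⟨0, rfl⟩, x, ?_, rfl⟩, ?_⟩
      · rintro ⟨i, hi⟩
        exact hx i hi
      · rintro e ⟨he, p, ⟨i, rfl⟩, y, hy, rfl⟩
        have hy' : ∀ i, g i ≠ y := fun i hi => hy ⟨i, hi⟩
        have he : G.Adj (g i) y := he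
        obtain rfl : i = 0 := by
          rcases outer g y hy' i he with h | rfl
          · exact h
          · exact absurd he (two g x y hx hy' h0)
        by_contra hne
        have hxy : x ≠ y := fun h => hne (by rw [h])
        exact hΔ (g 0) (g 1) (g 2) (g 3) x y e01 e02 e03 h0 he (by simp) (by simp) (hx 1) (hy' 1)
          (by simp) (hx 2) (hy' 2) (hx 3) (hy' 3) hxy
  rintro ⟨g⟩
  obtain ⟨i, x, hx, hix⟩ := exists_adj_of_embedding hconn hG3 g
  rcases outer g x hx i hix with rfl | rfl
  · exact pend g x hx hix
  · obtain ⟨k, hk⟩ : ∃ k : G3 ↪g G3, ∀ i, k i = (![4, 1, 2, 3, 0] : Fin 5 → Fin 5) i := by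
      refine exists_embedding_of_lt _ ?_ ?_ <;> simp [Fin.forall_fin_succ, G3]
    refine pend (k.trans g) x (fun i => hx _) ?_
    simpa [hk] using hix

/-! ### Even triangles, the octahedron, and sufficiency of the van Rooij–Wilf conditions. -/

/-- The octahedron is `L(K_4)`. The edges of `K_4` are listed so that edges `i` and `5 - i` are
disjoint while all other pairs meet. -/
theorem isLineGraph_of_octahedron_labels {V : Type u} {G : SimpleGraph V} (f : V → Fin 6)
    (hf : Function.Injective f)
    (hadj : ∀ x y, G.Adj x y ↔ x ≠ y ∧ (f x).val + (f y).val ≠ 5) : IsLineGraph G := by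
  let l : Fin 6 → Sym2 (Fin 4) := ![s(0, 1), s(0, 2), s(0, 3), s(1, 2), s(1, 3), s(2, 3)]
  have hl : Function.Injective l := by decide
  have hl2 : ∀ i j : Fin 6, i ≠ j → (i.val + j.val ≠ 5 ↔ ∃ k, k ∈ l i ∧ k ∈ l j) := by decide
  have hl3 : ∀ i, ¬ (l i).IsDiag := by decide
  refine isLineGraph_of_labels (I := ULift.{u} (Fin 4)) G (fun x => (l (f x)).map ULift.up)
    ?_ ?_ ?_
  · exact (Sym2.map.injective ULift.up_injective).comp (hl.comp hf)
  · intro x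
    rw [Sym2.isDiag_map ULift.up_injective]
    exact hl3 _
  · intro x y
    rw [hadj]
    refine and_congr_right fun hne => ?_
    rw [hl2 _ _ (hf.ne hne)]
    simp only [Sym2.mem_map]
    constructor
    · rintro ⟨k, h1, h2⟩
      exact ⟨_, ⟨k, h1, rfl⟩, k, h2, rfl⟩
    · rintro ⟨_, ⟨k, h1, rfl⟩, k', h2, h⟩
      obtain rfl := ULift.up_injective h
      exact ⟨_, h1, h2⟩

/-- A claw-free graph with two distinct even triangles that share an edge is an induced subgraph
of the octahedron. -/
theorem isLineGraph_of_even_triangles {V : Type u} {G : SimpleGraph V} (hconn : G.Connected)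
    (hclaw : ClawFree G) (hodd : OddDiamondFree G) (hΔ : DegreeLeFour G) {a b c d : V}
    (hab : G.Adj a b) (hac : G.Adj a c) (hbc : G.Adj b c) (hbd : G.Adj b d) (hcd : G.Adj c d)
    (had : a ≠ d) (h₁ : ∀ v, ¬ (G.Adj v a ↔ (G.Adj v b ↔ G.Adj v c)))
    (h₂ : ∀ v, ¬ (G.Adj v b ↔ (G.Adj v c ↔ G.Adj v d))) : IsLineGraph G := by
  have nad : ¬ G.Adj a d := fun h => h₁ d (by simp [h.symm, hbd.symm, hcd.symm])
  -- In the octahedron with `a` opposite `d`, the remaining vertices are the antipode of `c`, of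
  -- type `E b c`, and the antipode of `b`, of type `E c b`.
  let E : V → V → V → Prop := fun p q x =>
    x ≠ q ∧ G.Adj x a ∧ G.Adj x d ∧ G.Adj x p ∧ ¬ G.Adj x q
  have types : ∀ x, x ≠ a → x ≠ b → x ≠ c → x ≠ d →
      (G.Adj x a ∨ G.Adj x b ∨ G.Adj x c ∨ G.Adj x d) → E b c x ∨ E c b x := by
    intro x xa xb xc xd hx
    have e₁ := h₁ x
    have e₂ := h₂ x
    have h₃ : G.Adj x b → G.Adj x a ∨ G.Adj x d := by
      intro h
      rcases hclaw b a d x hab.symm hbd h.symm had xa.symm xd.symm with h | h | h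
      · exact absurd h nad
      · exact Or.inl h.symm
      · exact Or.inr h.symm
    simp only [E]
    clear hconn hclaw hodd hΔ h₁ h₂
    by_cases ha : G.Adj x a <;> by_cases hb : G.Adj x b <;> by_cases hc : G.Adj x c <;>
      by_cases hd : G.Adj x d <;> simp_all
  have cover : ∀ x, x = a ∨ x = b ∨ x = c ∨ x = d ∨ E b c x ∨ E c b x := by
    by_contra hcon
    rw [not_forall] at hcon
    obtain ⟨z, hz⟩ := hcon
    obtain ⟨x, hx, y, hy, hxy⟩ := exists_adj_boundary hconn
      (S := {x | x = a ∨ x = b ∨ x = c ∨ x = d ∨ E b c x ∨ E c b x}) (a := a) (b := z)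
      (Or.inl rfl) hz
    simp only [Set.mem_ofPred_eq, not_or] at hx hy
    obtain ⟨ya, yb, yc, yd, y1, y2⟩ := hy
    have hnone : ¬ (G.Adj y a ∨ G.Adj y b ∨ G.Adj y c ∨ G.Adj y d) := fun h =>
      (types y ya yb yc yd h).elim y1 y2
    have star : G.Adj x a → G.Adj x d → False := by
      intro h1 h2
      rcases hclaw x a d y h1 h2 hxy had (Ne.symm ya) (Ne.symm yd) with h | h | h
      · exact nad h
      · exact hnone (Or.inl h.symm)
      · exact hnone (Or.inr (Or.inr (Or.inr h.symm)))
    rcases hx with rfl | rfl | rfl | rfl | hx | hx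
    · exact hnone (Or.inl hxy.symm)
    · exact hnone (Or.inr (Or.inl hxy.symm))
    · exact hnone (Or.inr (Or.inr (Or.inl hxy.symm)))
    · exact hnone (Or.inr (Or.inr (Or.inr hxy.symm)))
    · exact star hx.2.1 hx.2.2.1
    · exact star hx.2.1 hx.2.2.1
  -- Otherwise `p` has the five neighbours `a, d, q, x, y`.
  have uniq : ∀ p q x y, G.Adj p q → G.Adj p a → G.Adj p d → G.Adj q a → G.Adj q d →
      E p q x → E p q y → x = y := by
    rintro p q x y hpq hpa hpd hqa hqd ⟨nx, xa, xd, xp, xq⟩ ⟨ny, ya, yd, yp, yq⟩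
    by_contra hne
    exact hΔ p a d q x y hpa hpd hpq xp.symm yp.symm had hqa.ne.symm xa.ne.symm ya.ne.symm
      hqd.ne.symm xd.ne.symm yd.ne.symm nx.symm ny.symm hne
  -- If `x` and `y` were non-adjacent, `y` would see only `a` in the triangle `b x a` and only `d`
  -- in `b x d`. Both would be odd, forcing `a` and `d` to be adjacent.
  have opp : ∀ x y, E b c x → E c b y → G.Adj x y := by
    rintro x y ⟨nx, xa, xd, xb, xc⟩ ⟨ny, ya, yd, yc, yb⟩
    by_contra hxy
    refine nad (hodd a b x d ⟨xb.symm, hab.symm, xa, y, ?_⟩ ⟨xb.symm, hbd, xd, y, ?_⟩ had)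
    · simp [yb, ya, mt Adj.symm hxy]
    · simp [yb, yd, mt Adj.symm hxy]
  -- Antipodes receive numbers with sum five.
  have hcode : ∀ x, ∃ i : Fin 6, (i = 0 ∧ x = a) ∨ (i = 1 ∧ x = b) ∨ (i = 2 ∧ x = c) ∨
      (i = 5 ∧ x = d) ∨ (i = 3 ∧ E b c x) ∨ (i = 4 ∧ E c b x) := by
    intro x
    rcases cover x with h | h | h | h | h | h
    exacts [⟨0, by simp [h]⟩, ⟨1, by simp [h]⟩, ⟨2, by simp [h]⟩, ⟨5, by simp [h]⟩,
      ⟨3, by simp [h]⟩, ⟨4, by simp [h]⟩]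
  choose f hf using hcode
  refine isLineGraph_of_octahedron_labels f ?_ ?_
  · intro x y hxy
    have hx := hf x
    have hy := hf y
    rw [hxy] at hx
    have u1 := uniq b c x y hbc hab.symm hbd hac.symm hcd
    have u2 := uniq c b x y hbc.symm hac.symm hcd hab.symm hbd
    generalize f y = i at hx hy
    fin_cases i <;> simp at hx hy
    · rw [hx, hy]
    · rw [hx, hy]
    · rw [hx, hy]
    · exact u1 hx hy
    · exact u2 hx hy
    · rw [hx, hy]
  · intro x y
    have hx := hf x
    have hy := hf y
    have u1 := uniq b c x y hbc hab.symm hbd hac.symm hcd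
    have u2 := uniq c b x y hbc.symm hac.symm hcd hab.symm hbd
    have o1 := opp x y
    have o2 := opp y x
    generalize f x = i at hx
    generalize f y = j at hy
    have hEb : ∀ z, E b c z → z ≠ a ∧ z ≠ d ∧ z ≠ b ∧ z ≠ c ∧ G.Adj z a ∧ G.Adj z d ∧ G.Adj z b ∧
      ¬ G.Adj z c := fun z h => ⟨h.2.1.ne, h.2.2.1.ne, h.2.2.2.1.ne, h.1, h.2⟩
    have hEc : ∀ z, E c b z → z ≠ a ∧ z ≠ d ∧ z ≠ c ∧ z ≠ b ∧ G.Adj z a ∧ G.Adj z d ∧ G.Adj z c ∧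
      ¬ G.Adj z b := fun z h => ⟨h.2.1.ne, h.2.2.1.ne, h.2.2.2.1.ne, h.1, h.2⟩
    have hx1 := hEb x
    have hx2 := hEc x
    have hy1 := hEb y
    have hy2 := hEc y
    have nab := hab.ne
    have nac := hac.ne
    have nbc := hbc.ne
    have nbd := hbd.ne
    have ncd := hcd.ne
    have sadj := G.adj_comm
    clear_value E
    clear hconn hclaw hodd hΔ h₁ h₂ types cover uniq opp hf hEb hEc
    rcases hx with ⟨rfl, hx⟩ | ⟨rfl, hx⟩ | ⟨rfl, hx⟩ | ⟨rfl, hx⟩ | ⟨rfl, hx⟩ | ⟨rfl, hx⟩ <;>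
    rcases hy with ⟨rfl, hy⟩ | ⟨rfl, hy⟩ | ⟨rfl, hy⟩ | ⟨rfl, hy⟩ | ⟨rfl, hy⟩ | ⟨rfl, hy⟩ <;>
    grind [SimpleGraph.irrefl]

theorem isLineGraph_of_clawFree_of_oddDiamondFree {V : Type u} [Finite V] {G : SimpleGraph V}
    (hconn : G.Connected) (hnb : ∀ x, ∃ y, G.Adj x y) (hclaw : ClawFree G)
    (hodd : OddDiamondFree G) (hΔ : DegreeLeFour G) : IsLineGraph G := by
  by_cases hQ : ∃ a b c d, G.Adj b c ∧ G.Adj b a ∧ G.Adj c a ∧ G.Adj b d ∧ G.Adj c d ∧ a ≠ d ∧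
      ¬ OddTriangle G b c a ∧ ¬ OddTriangle G b c d
  · obtain ⟨a, b, c, d, hbc, hab, hac, hbd, hcd, had, h₁, h₂⟩ := hQ
    refine isLineGraph_of_even_triangles hconn hclaw hodd hΔ hab.symm hac.symm hbc hbd hcd had
      (fun v hv => h₁ ⟨hbc, hab, hac, v, ?_⟩) (fun v hv => h₂ ⟨hbc, hbd, hcd, v, hv⟩)
    tauto
  have swap12 : ∀ x y z, OddTriangle G x y z → OddTriangle G y x z := by
    rintro x y z ⟨h1, h2, h3, v, hv⟩
    exact ⟨h1.symm, h3, h2, v, by tauto⟩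
  have swap23 : ∀ x y z, OddTriangle G x y z → OddTriangle G x z y := by
    rintro x y z ⟨h1, h2, h3, v, hv⟩
    exact ⟨h2, h1, h3.symm, v, by tauto⟩
  refine isLineGraph_of_triangles G (OddTriangle G) (fun _ _ _ h => h.1) swap12 swap23 ?_ ?_ hnb
  · intro x y z w hz hw hne
    -- The triangle `x z w` is odd because `y` is adjacent to all three of its vertices.
    have hzw := hodd z x y w hz hw hne
    exact ⟨hz.2.1, hw.2.1, hzw, y, by simp [hz.1.symm, hz.2.2.1, hw.2.2.1]⟩
  -- If `x p q` is even, the neighbour `r` of `x` is adjacent to exactly one of `p`, `q`. The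
  -- triangle this creates shares an edge with an even one, so it must be odd.
  · have two : ∀ x p q r, G.Adj x p → G.Adj x q → G.Adj x r → p ≠ r → q ≠ r → G.Adj p q →
        ¬ OddTriangle G x p q → OddTriangle G x p r ∨ OddTriangle G x q r := by
      intro x p q r hp hq hr hpr hqr hpq h
      by_contra! hcon
      have hv : ¬ (G.Adj r x ↔ (G.Adj r p ↔ G.Adj r q)) := fun hv => h ⟨hp, hq, hpq, r, hv⟩
      by_cases hrp : G.Adj r p
      · exact hQ ⟨q, x, p, r, hp, hq, hpq, hr, hrp.symm, hqr, h, hcon.1⟩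
      · have hrq : G.Adj r q := by
          by_contra hrq
          exact hv (by simp [hr.symm, hrp, hrq])
        exact hQ ⟨p, x, q, r, hq, hp, hpq.symm, hr, hrq.symm, hpr, fun h' => h (swap23 _ _ _ h'),
          hcon.2⟩
    intro x a b c ha hb hc hab hac hbc
    by_contra! hcon
    obtain ⟨n1, n2, n3⟩ := hcon
    rcases hclaw x a b c ha hb hc hab hac hbc with h | h | h
    · exact (two x a b c ha hb hc hac hbc h n1).elim n2 n3
    · exact (two x a c b ha hc hb hab hbc.symm h n2).elim n1 (fun h => n3 (swap23 _ _ _ h))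
    · exact (two x b c a hb hc ha hab.symm hac.symm h n3).elim (fun h => n1 (swap23 _ _ _ h))
        (fun h => n2 (swap23 _ _ _ h))

/-! ### Part (a). -/

theorem degreeLeFour_of_maxDegree {V : Type*} [Fintype V] {G : SimpleGraph V}
    [DecidableRel G.Adj] (h : G.maxDegree ≤ 4) : DegreeLeFour G := by
  classical
  intro x a b c d e ha hb hc hd he hab hac had hae hbc hbd hbe hcd hce hde
  have hsub : ({a, b, c, d, e} : Finset V) ⊆ G.neighborFinset x := by
    intro y hy
    simp only [Finset.mem_insert, Finset.mem_singleton] at hy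
    rw [mem_neighborFinset]
    rcases hy with rfl | rfl | rfl | rfl | rfl <;> assumption
  have hcard : ({a, b, c, d, e} : Finset V).card = 5 := by
    simp [*]
  have := Finset.card_le_card hsub
  rw [card_neighborFinset_eq_degree, hcard] at this
  have := G.degree_le_maxDegree x
  omega

theorem IsLineGraph.not_containsPendant_G3 {V : Type u} {G : SimpleGraph V}
    (h : IsLineGraph G) (hΔ : DegreeLeFour G) : ¬ ContainsPendant G3 G := by
  rintro ⟨K, ⟨φ⟩, e, ⟨he, x, hx, y, hy, rfl⟩, -⟩
  have hadj : ∀ i j, G3.Adj i j → G.Adj (φ i) (φ j) := fun i j hij =>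
    K.adj_sub (φ.map_adj_iff.2 hij)
  have hinj : ∀ i j, i ≠ j → (φ i : V) ≠ φ j := fun i j hij heq =>
    hij (φ.injective (Subtype.ext heq))
  -- A pendant copy need not be induced. If the missing edge is present in `G`, the copy spans a
  -- `K_5` and its vertex on the outgoing edge has degree five.
  by_cases h04 : G.Adj (φ 0) (φ 4)
  · have full : ∀ i j, i ≠ j → G.Adj (φ i) (φ j) := by
      intro i j hij
      by_cases hG : G3.Adj i j
      · exact hadj i j hG
      · have : (i = 0 ∧ j = 4) ∨ (i = 4 ∧ j = 0) := by
          clear h04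
          revert i j
          simp [Fin.forall_fin_succ, G3]
        rcases this with ⟨rfl, rfl⟩ | ⟨rfl, rfl⟩
        exacts [h04, h04.symm]
    obtain ⟨i, hi⟩ := φ.surjective ⟨x, hx⟩
    have hxy : G.Adj (φ i) y := by
      rw [hi]
      exact he
    have hne : ∀ j, (φ j : V) ≠ y := by
      rintro j rfl
      exact hy (φ j).2
    have h5 : ∃ p q r s : Fin 5, p ≠ i ∧ q ≠ i ∧ r ≠ i ∧ s ≠ i ∧ p ≠ q ∧ p ≠ r ∧ p ≠ s ∧ q ≠ r ∧
        q ≠ s ∧ r ≠ s := by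
      clear hi hxy
      revert i
      decide
    obtain ⟨p, q, r, s, hp, hq, hr, hs, hpq, hpr, hps, hqr, hqs, hrs⟩ := h5
    exact hΔ (φ i) (φ p) (φ q) (φ r) (φ s) y (full _ _ hp.symm) (full _ _ hq.symm)
      (full _ _ hr.symm) (full _ _ hs.symm) hxy (hinj _ _ hpq) (hinj _ _ hpr) (hinj _ _ hps)
      (hne p) (hinj _ _ hqr) (hinj _ _ hqs) (hne q) (hinj _ _ hrs) (hne r) (hne s)
  · obtain ⟨f, -⟩ : ∃ f : G3 ↪g G, ∀ i, f i = φ i := by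
      refine exists_embedding_of_lt _ (fun i j hij => hinj i j hij.ne) (fun i j hij => ?_)
      refine ⟨fun hG => ?_, hadj i j⟩
      by_contra hn
      have : i = 0 ∧ j = 4 := by
        clear hG
        revert i j
        simp [Fin.forall_fin_succ, G3]
      obtain ⟨rfl, rfl⟩ := this
      exact h04 hG
    exact not_oddDiamondFree_G3 (h.oddDiamondFree.of_embedding f)

theorem isLineGraph_iff_forbidden {V : Type u} [Finite V] {G : SimpleGraph V}
    (hconn : G.Connected) (hnb : ∀ x, ∃ y, G.Adj x y) (hΔ : DegreeLeFour G)
    (hG3 : IsEmpty (G ≃g G3)) (hG8 : IsEmpty (G ≃g G8)) (hH1 : IsEmpty (G ≃g H1)) :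
    IsLineGraph G ↔ (¬ G1.IsIndContained G ∧ ¬ G2.IsIndContained G ∧ ¬ G4.IsIndContained G ∧
      ¬ G5.IsIndContained G ∧ ¬ G6.IsIndContained G ∧ ¬ G7.IsIndContained G ∧
      ¬ ContainsPendant G3 G) := by
  constructor
  · intro h
    have hc := h.clawFree
    have ho := h.oddDiamondFree
    exact ⟨fun ⟨f⟩ => not_clawFree_G1 (hc.of_embedding f),
      fun ⟨f⟩ => not_oddDiamondFree_G2 (ho.of_embedding f),
      fun ⟨f⟩ => not_oddDiamondFree_G4 (ho.of_embedding f),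
      fun ⟨f⟩ => not_oddDiamondFree_G5 (ho.of_embedding f),
      fun ⟨f⟩ => not_oddDiamondFree_G6 (ho.of_embedding f),
      fun ⟨f⟩ => not_oddDiamondFree_G7 (ho.of_embedding f), h.not_containsPendant_G3 hΔ⟩
  · rintro ⟨h₁, h₂, h₄, h₅, -, h₇, hp⟩
    have h₃ := not_isIndContained_G3 hconn h₂ h₄ h₇ hp hΔ hG3
    have h₈ := not_isIndContained_G8 hconn h₁ h₂ h₄ h₇ hΔ hG8 hH1
    refine isLineGraph_of_clawFree_of_oddDiamondFree hconn hnb ?_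
      (oddDiamondFree_of_forbidden h₁ h₂ h₃ h₄ h₅ h₇ h₈ hΔ) hΔ
    intro a b c d hab hac had hbc hbd hcd
    by_contra! hcon
    exact h₁ (G1.isIndContained_of_adj hab hac had hcon.1 hcon.2.1 hcon.2.2 hbc hbd hcd)

/-! ### The graphs `S`, `T`, `L` and their line graphs. -/

/-- The position in a path `0, …, n` of the end that carries the `p`-th pair. -/
def endIdx {k : ℕ} (n : ℕ) (p : Fin k) : Fin (n + 1) := if p.val = 0 then 0 else Fin.last n

theorem endIdx_val {k : ℕ} (n : ℕ) (p : Fin k) :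
    (endIdx n p).val = if p.val = 0 then 0 else n := by
  unfold endIdx
  split <;> simp

/-- A path on `n + 1` vertices together with, for each `p < k`, a pair of adjacent vertices, both
joined to an end of the path. -/
def T (k n : ℕ) : SimpleGraph (Fin (n + 1) ⊕ (Fin k × Fin 2)) :=
  SimpleGraph.fromRel fun x y => match x, y with
    | .inl i, .inl j => i.val + 1 = j.val
    | .inl i, .inr (p, _) => i = endIdx n p
    | .inr _, .inl _ => False
    | .inr (p, _), .inr (q, _) => p = q

/-- A path on `n + 1` vertices together with, for each `p < k`, two pendant vertices at an end of
the path. -/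
def S (k n : ℕ) : SimpleGraph (Fin (n + 1) ⊕ (Fin k × Fin 2)) :=
  SimpleGraph.fromRel fun x y => match x, y with
    | .inl i, .inl j => i.val + 1 = j.val
    | .inl i, .inr (p, _) => i = endIdx n p
    | .inr _, .inl _ => False
    | .inr _, .inr _ => False

section adj
variable {k n : ℕ}

theorem T_adj_inl_inl (i j : Fin (n + 1)) :
    (T k n).Adj (.inl i) (.inl j) ↔ i.val + 1 = j.val ∨ j.val + 1 = i.val := by
  simp only [T, fromRel_adj, ne_eq, Sum.inl.injEq, and_iff_right_iff_imp]
  rintro h rfl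
  omega

theorem T_adj_inl_inr (i : Fin (n + 1)) (p : Fin k × Fin 2) :
    (T k n).Adj (.inl i) (.inr p) ↔ i = endIdx n p.1 := by
  simp [T]

theorem T_adj_inr_inl (i : Fin (n + 1)) (p : Fin k × Fin 2) :
    (T k n).Adj (.inr p) (.inl i) ↔ i = endIdx n p.1 := by
  rw [adj_comm, T_adj_inl_inr]

theorem T_adj_inr_inr (p q : Fin k × Fin 2) :
    (T k n).Adj (.inr p) (.inr q) ↔ p.1 = q.1 ∧ p.2 ≠ q.2 := by
  obtain ⟨p, t⟩ := p
  obtain ⟨q, s⟩ := q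
  simp only [T, fromRel_adj, ne_eq, Sum.inr.injEq, Prod.mk.injEq]
  grind

theorem S_adj_inl_inl (i j : Fin (n + 1)) :
    (S k n).Adj (.inl i) (.inl j) ↔ i.val + 1 = j.val ∨ j.val + 1 = i.val := by
  simp only [S, fromRel_adj, ne_eq, Sum.inl.injEq, and_iff_right_iff_imp]
  rintro h rfl
  omega

theorem S_adj_inl_inr (i : Fin (n + 1)) (p : Fin k × Fin 2) :
    (S k n).Adj (.inl i) (.inr p) ↔ i = endIdx n p.1 := by
  simp [S]

theorem S_not_adj_inr_inr (p q : Fin k × Fin 2) : ¬ (S k n).Adj (.inr p) (.inr q) := by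
  simp [S]

theorem L_adj_inl_inl (i j : Fin n) :
    (L k n).Adj (.inl i) (.inl j) ↔ i.val + 1 = j.val ∨ j.val + 1 = i.val := by
  simp only [L, LRel, fromRel_adj, ne_eq, Sum.inl.injEq, and_iff_right_iff_imp]
  rintro h rfl
  omega

theorem L_adj_inl_inr (i : Fin n) (p : Fin k × Fin 3) :
    (L k n).Adj (.inl i) (.inr p) ↔ p.2 ≠ 0 ∧ i.val = if p.1.val = 0 then 0 else n - 1 := by
  simp [L, LRel]

theorem L_adj_inr_inr (p q : Fin k × Fin 3) :
    (L k n).Adj (.inr p) (.inr q) ↔ p.1 = q.1 ∧ p.2 ≠ q.2 := by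
  obtain ⟨p, t⟩ := p
  obtain ⟨q, s⟩ := q
  simp only [L, LRel, fromRel_adj, ne_eq, Sum.inr.injEq, Prod.mk.injEq]
  grind

end adj

theorem exists_mem_mk_mk {α : Type*} {a b c d : α} :
    (∃ i, i ∈ s(a, b) ∧ i ∈ s(c, d)) ↔ a = c ∨ a = d ∨ b = c ∨ b = d := by
  simp only [Sym2.mem_iff]
  constructor
  · rintro ⟨i, rfl | rfl, rfl | rfl⟩ <;> simp
  · rintro (rfl | rfl | rfl | rfl)
    exacts [⟨_, .inl rfl, .inl rfl⟩, ⟨_, .inl rfl, .inr rfl⟩, ⟨_, .inr rfl, .inl rfl⟩,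
      ⟨_, .inr rfl, .inr rfl⟩]

/-- A symmetric form of the adjacency condition on labels that is convenient for sum types. -/
theorem adj_iff_of_sum {A B : Type*} {G : SimpleGraph (A ⊕ B)} {P : A ⊕ B → A ⊕ B → Prop}
    (hP : ∀ x y, P x y → P y x)
    (h1 : ∀ i j, G.Adj (.inl i) (.inl j) ↔ i ≠ j ∧ P (.inl i) (.inl j))
    (h2 : ∀ i j, G.Adj (.inl i) (.inr j) ↔ P (.inl i) (.inr j))
    (h3 : ∀ i j, G.Adj (.inr i) (.inr j) ↔ i ≠ j ∧ P (.inr i) (.inr j)) (x y : A ⊕ B) :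
    G.Adj x y ↔ x ≠ y ∧ P x y := by
  rcases x with i | i <;> rcases y with j | j
  · simpa using h1 i j
  · simpa using h2 i j
  · rw [G.adj_comm, h2]
    simpa using ⟨hP _ _, hP _ _⟩
  · simpa using h3 i j

/-- Path edges become path vertices, so the path loses one vertex, and the two pendant edges at an
end become an adjacent pair. The bound `k ≤ 2` is needed because `endIdx` sends every `p ≠ 0` to the
same end. -/
theorem nonempty_iso_T {k : ℕ} (hk : k ≤ 2) (n : ℕ) :
    Nonempty (T k n ≃g (S k (n + 1)).lineGraph) := by
  let f : Fin (n + 1) ⊕ (Fin k × Fin 2) → Sym2 (Fin (n + 2) ⊕ (Fin k × Fin 2)) :=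
    Sum.elim (fun i => s(.inl i.castSucc, .inl i.succ))
      (fun p => s(.inr p, .inl (endIdx (n + 1) p.1)))
  refine nonempty_iso_lineGraph_of_labels _ _ f ?_ ?_ ?_
  · rintro (i | p) (j | q) h
    · simp only [f, Sum.elim_inl, Sym2.eq_iff, Sum.inl.injEq, Fin.ext_iff, Fin.val_castSucc,
        Fin.val_succ] at h
      congr 1
      ext
      omega
    · simp [f] at h
    · simp [f] at h
    · have h : p = q ∧ endIdx (n + 1) p.1 = endIdx (n + 1) q.1 := by simpa [f] using h
      rw [h.1]
  · ext e
    induction e with | _ x y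
    constructor
    · rintro ⟨i | p, h⟩
      · rw [← h]
        exact (S_adj_inl_inl _ _).2 (Or.inl (by simp))
      · rw [← h]
        exact ((S_adj_inl_inr _ _).2 rfl).symm
    · intro h
      rw [mem_edgeSet] at h
      have key : ∀ i j : Fin (n + 2), i.val + 1 = j.val →
          s(Sum.inl i, Sum.inl j) ∈ Set.range f := by
        intro i j hij
        refine ⟨.inl ⟨i, by omega⟩, ?_⟩
        simp only [f, Sum.elim_inl, Fin.castSucc_mk, Fin.succ_mk, hij]
      rcases x with i | p <;> rcases y with j | q
      · rcases (S_adj_inl_inl _ _).1 h with h | h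
        · exact key i j h
        · rw [Sym2.eq_swap]
          exact key j i h
      · rw [(S_adj_inl_inr _ _).1 h, Sym2.eq_swap]
        exact ⟨.inr q, rfl⟩
      · rw [(S_adj_inl_inr _ _).1 h.symm]
        exact ⟨.inr p, rfl⟩
      · exact absurd h (S_not_adj_inr_inr _ _)
  · refine adj_iff_of_sum (P := fun x y => ∃ i, i ∈ f x ∧ i ∈ f y) ?_ ?_ ?_ ?_
    · rintro x y ⟨i, h1, h2⟩
      exact ⟨i, h2, h1⟩
    · intro i j
      simp only [f, Sum.elim_inl, exists_mem_mk_mk, T_adj_inl_inl, Sum.inl.injEq, Fin.ext_iff,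
        Fin.val_castSucc, Fin.val_succ, ne_eq]
      omega
    · rintro i ⟨p, t⟩
      simp only [f, Sum.elim_inl, Sum.elim_inr, exists_mem_mk_mk, T_adj_inl_inr, Sum.inl.injEq,
        Fin.ext_iff, Fin.val_castSucc, Fin.val_succ, reduceCtorEq, endIdx_val]
      split_ifs <;> grind
    · rintro ⟨p, t⟩ ⟨q, s⟩
      simp only [f, Sum.elim_inr, exists_mem_mk_mk, T_adj_inr_inr, Sum.inr.injEq, Sum.inl.injEq,
        Prod.mk.injEq, Fin.ext_iff, reduceCtorEq, endIdx_val, ne_eq]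
      split_ifs <;> grind

/-- In an end triangle of `T k n`, the side opposite the path becomes the vertex of index `0`, and
the two sides at the path become those joined to the path in `L k n`. With `1 ≤ n` the two ends of
the path are distinct. -/
theorem nonempty_iso_L {k : ℕ} (hk : k ≤ 2) {n : ℕ} (hn : 1 ≤ n) :
    Nonempty (L k n ≃g (T k n).lineGraph) := by
  let f : Fin n ⊕ (Fin k × Fin 3) → Sym2 (Fin (n + 1) ⊕ (Fin k × Fin 2)) :=
    Sum.elim (fun i => s(.inl i.castSucc, .inl i.succ))
      (fun p => (![s(.inr (p.1, 0), .inr (p.1, 1)), s(.inr (p.1, 0), .inl (endIdx n p.1)),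
        s(.inr (p.1, 1), .inl (endIdx n p.1))] : Fin 3 → _) p.2)
  refine nonempty_iso_lineGraph_of_labels _ _ f ?_ ?_ ?_
  · rintro (i | ⟨p, t⟩) (j | ⟨q, s⟩) h
    · simp only [f, Sum.elim_inl, Sym2.eq_iff, Sum.inl.injEq, Fin.ext_iff, Fin.val_castSucc,
        Fin.val_succ] at h
      congr 1
      ext
      omega
    · fin_cases s <;> simp [f] at h
    · fin_cases t <;> simp [f] at h
    · fin_cases s <;> fin_cases t <;> simp_all [f]
  · ext e
    induction e with | _ x y
    constructor
    · rintro ⟨i | ⟨p, t⟩, h⟩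
      · rw [← h]
        exact (T_adj_inl_inl _ _).2 (Or.inl (by simp))
      · rw [← h]
        fin_cases t
        · exact (T_adj_inr_inr _ _).2 ⟨rfl, by simp⟩
        · exact (T_adj_inr_inl _ _).2 rfl
        · exact (T_adj_inr_inl _ _).2 rfl
    · intro h
      rw [mem_edgeSet] at h
      have key : ∀ i j : Fin (n + 1), i.val + 1 = j.val →
          s(Sum.inl i, Sum.inl j) ∈ Set.range f := by
        intro i j hij
        refine ⟨.inl ⟨i, by omega⟩, ?_⟩
        simp only [f, Sum.elim_inl, Fin.castSucc_mk, Fin.succ_mk, hij]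
      have key2 : ∀ p : Fin k × Fin 2, s(Sum.inr p, Sum.inl (endIdx n p.1)) ∈ Set.range f := by
        rintro ⟨p, t⟩
        fin_cases t
        · exact ⟨.inr (p, 1), rfl⟩
        · exact ⟨.inr (p, 2), rfl⟩
      rcases x with i | p <;> rcases y with j | q
      · rcases (T_adj_inl_inl _ _).1 h with h | h
        · exact key i j h
        · rw [Sym2.eq_swap]
          exact key j i h
      · rw [(T_adj_inl_inr _ _).1 h, Sym2.eq_swap]
        exact key2 q
      · rw [(T_adj_inl_inr _ _).1 h.symm]
        exact key2 p
      · obtain ⟨p, t⟩ := p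
        obtain ⟨q, s⟩ := q
        obtain ⟨h1, h2⟩ := (T_adj_inr_inr _ _).1 h
        obtain rfl : p = q := h1
        refine ⟨.inr (p, 0), ?_⟩
        fin_cases s <;> fin_cases t <;> simp_all [f]
  · refine adj_iff_of_sum (P := fun x y => ∃ i, i ∈ f x ∧ i ∈ f y) ?_ ?_ ?_ ?_
    · rintro x y ⟨i, h1, h2⟩
      exact ⟨i, h2, h1⟩
    · intro i j
      simp only [f, Sum.elim_inl, exists_mem_mk_mk, L_adj_inl_inl, Sum.inl.injEq, Fin.ext_iff,
        Fin.val_castSucc, Fin.val_succ, ne_eq]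
      omega
    · rintro i ⟨p, t⟩
      rw [L_adj_inl_inr]
      fin_cases t
      · simp [f]
      all_goals
        simp [f, Fin.ext_iff, endIdx_val]
        split <;> omega
    · rintro ⟨p, t⟩ ⟨q, s⟩
      rw [L_adj_inr_inr]
      have hpq : (endIdx n p).val = (endIdx n q).val ↔ p = q := by
        rw [endIdx_val, endIdx_val, Fin.ext_iff]
        split <;> split <;> omega
      rw [← Fin.ext_iff] at hpq
      fin_cases t <;> fin_cases s <;>
        simp [f, hpq]

/-! ### Components under the line graph operation. -/

/-- `f` embeds `A` as a union of connected components of `B`. -/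
def IsComponentEmbedding {V W : Type*} (A : SimpleGraph V) (B : SimpleGraph W) (f : V → W) :
    Prop :=
  Function.Injective f ∧ ∀ x y, B.Adj (f x) y ↔ ∃ z, A.Adj x z ∧ f z = y

theorem IsComponentEmbedding.adj_iff {V W : Type*} {A : SimpleGraph V} {B : SimpleGraph W}
    {f : V → W} (h : IsComponentEmbedding A B f) (x y : V) : B.Adj (f x) (f y) ↔ A.Adj x y := by
  rw [h.2]
  constructor
  · rintro ⟨z, hz, hzy⟩
    rwa [← h.1 hzy]
  · exact fun hxy => ⟨y, hxy, rfl⟩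

/-- A connected line graph may have a disconnected root, since edgeless components vanish; this is
why components are tracked. An edge meeting the image of `f` at a vertex has its other end in the
image too. -/
theorem IsComponentEmbedding.lineGraph {V W : Type*} {A : SimpleGraph V} {B : SimpleGraph W}
    {f : V → W} (h : IsComponentEmbedding A B f) :
    ∃ g, IsComponentEmbedding A.lineGraph B.lineGraph g := by
  let φ : A ↪g B := ⟨⟨f, h.1⟩, h.adj_iff _ _⟩
  let ψ := φ.toCopy.toLineGraphEmbedding
  refine ⟨ψ, ψ.injective, fun e y => ⟨fun hy => ?_, ?_⟩⟩
  · obtain ⟨v, hv, hvy⟩ := (lineGraph_adj_iff_exists.1 hy).2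
    obtain ⟨a, -, rfl⟩ := Sym2.mem_map.1 hv
    obtain ⟨y, hyB⟩ := y
    obtain ⟨w, rfl⟩ := hvy
    obtain ⟨z, hz, rfl⟩ := (h.2 a w).1 hyB
    have heq : ψ ⟨s(a, z), hz⟩ = ⟨s(f a, f z), hyB⟩ := rfl
    refine ⟨⟨s(a, z), hz⟩, ?_, heq⟩
    rw [← ψ.map_adj_iff, heq]
    exact hy
  · rintro ⟨z, hz, rfl⟩
    exact ψ.map_adj_iff.2 hz

theorem IsComponentEmbedding.nonempty_iso {V W : Type*} {A : SimpleGraph V} {B : SimpleGraph W}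
    {f : V → W} (h : IsComponentEmbedding A B f) (hB : B.Connected) [Nonempty V] :
    Nonempty (A ≃g B) := by
  have hs : Function.Surjective f := by
    by_contra hs
    simp only [Function.Surjective, not_forall] at hs
    obtain ⟨b, hb⟩ := hs
    obtain ⟨_, ⟨x, rfl⟩, y, hy, hxy⟩ := exists_adj_boundary hB (S := Set.range f)
      (Set.mem_range_self (Classical.arbitrary V)) hb
    obtain ⟨z, -, rfl⟩ := (h.2 x y).1 hxy
    exact hy ⟨z, rfl⟩
  exact ⟨⟨Equiv.ofBijective f ⟨h.1, hs⟩, h.adj_iff _ _⟩⟩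

/-! ### Degrees in line graphs. -/

/-- The degree, as the cardinality of the set of neighbours. -/
noncomputable def ndeg {V : Type*} (G : SimpleGraph V) (x : V) : ℕ := (G.neighborSet x).ncard

theorem ndeg_iso {V W : Type*} {A : SimpleGraph V} {B : SimpleGraph W} (e : A ≃g B) (x : V) :
    ndeg B (e x) = ndeg A x := by
  have : B.neighborSet (e x) = e '' A.neighborSet x := by
    ext y
    simp only [mem_neighborSet, Set.mem_image]
    constructor
    · intro h
      refine ⟨e.symm y, ?_, by simp⟩
      rw [← e.map_adj_iff]
      simpa using h
    · rintro ⟨z, hz, rfl⟩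
      exact e.map_adj_iff.2 hz
  rw [ndeg, this, Set.ncard_image_of_injective _ e.injective, ndeg]

theorem ncard_incidenceSet {V : Type*} (G : SimpleGraph V) (x : V) :
    (G.incidenceSet x).ncard = ndeg G x := by
  classical
  exact Nat.card_congr (G.incidenceSetEquivNeighborSet x)

/-- Inclusion–exclusion on the edges at `a` and at `b`: the edge `a b` is counted at both ends and
is not its own neighbour. -/
theorem ndeg_lineGraph {V : Type*} [Finite V] {G : SimpleGraph V} {a b : V} (h : G.Adj a b) :
    ndeg G.lineGraph ⟨s(a, b), h⟩ + 2 = ndeg G a + ndeg G b := by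
  classical
  have himg : Subtype.val '' G.lineGraph.neighborSet ⟨s(a, b), h⟩ =
      (G.incidenceSet a ∪ G.incidenceSet b) \ {s(a, b)} := by
    ext e
    simp only [Set.mem_image, mem_neighborSet, lineGraph_adj_iff_exists, Set.mem_sdiff,
      Set.mem_union, Set.mem_singleton_iff, incidenceSet, Set.mem_sep_iff]
    constructor
    · rintro ⟨⟨e, he⟩, ⟨hne, v, hv, hve⟩, rfl⟩
      refine ⟨?_, fun h => hne (Subtype.ext h.symm)⟩
      rcases Sym2.mem_iff.1 hv with rfl | rfl
      · exact Or.inl ⟨he, hve⟩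
      · exact Or.inr ⟨he, hve⟩
    · rintro ⟨⟨he, hv⟩ | ⟨he, hv⟩, hne⟩
      · exact ⟨⟨e, he⟩, ⟨fun h => hne (congrArg Subtype.val h).symm, a, by simp, hv⟩, rfl⟩
      · exact ⟨⟨e, he⟩, ⟨fun h => hne (congrArg Subtype.val h).symm, b, by simp, hv⟩, rfl⟩
  have hinter : G.incidenceSet a ∩ G.incidenceSet b = {s(a, b)} :=
    G.incidenceSet_inter_incidenceSet_of_adj h
  have h1 := Set.ncard_union_add_ncard_inter (G.incidenceSet a) (G.incidenceSet b)
  rw [hinter, Set.ncard_singleton, ncard_incidenceSet, ncard_incidenceSet] at h1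
  have hmem : s(a, b) ∈ G.incidenceSet a ∪ G.incidenceSet b :=
    Or.inl (G.mk'_mem_incidenceSet_left_iff.2 h)
  have h2 := Set.ncard_sdiff_singleton_add_one hmem
  rw [← himg, Set.ncard_image_of_injective _ Subtype.val_injective] at h2
  rw [ndeg]
  omega

/-- The constant is `2` for the outer line graph plus `2` for each of the edges `a b` and `b c`. -/
theorem ndeg_lineGraph_lineGraph {V : Type*} [Finite V] {G : SimpleGraph V} {a b c : V}
    (hab : G.Adj a b) (hbc : G.Adj b c) (hac : a ≠ c) :
    ∃ e, ndeg G.lineGraph.lineGraph e + 6 = ndeg G a + 2 * ndeg G b + ndeg G c := by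
  have hadj : G.lineGraph.Adj ⟨s(a, b), hab⟩ ⟨s(b, c), hbc⟩ := by
    rw [lineGraph_adj_iff_exists]
    refine ⟨fun h => ?_, b, by simp, by simp⟩
    have := Subtype.ext_iff.1 h
    simp only [Sym2.eq_iff] at this
    have := hab.ne
    tauto
  refine ⟨⟨s(⟨s(a, b), hab⟩, ⟨s(b, c), hbc⟩), hadj⟩, ?_⟩
  have h1 := ndeg_lineGraph hadj
  have h2 := ndeg_lineGraph hab
  have h3 := ndeg_lineGraph hbc
  omega

theorem exists_path_of_lineGraph_lineGraph {V : Type*} [Finite V] {G : SimpleGraph V}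
    (e : G.lineGraph.edgeSet) : ∃ a b c, G.Adj a b ∧ G.Adj b c ∧ a ≠ c ∧
      ndeg G.lineGraph.lineGraph e + 6 = ndeg G a + 2 * ndeg G b + ndeg G c := by
  obtain ⟨e, he⟩ := e
  induction e with | _ p q
  obtain ⟨hne, b, hbp, hbq⟩ := lineGraph_adj_iff_exists.1 he
  obtain ⟨p, hp⟩ := p
  obtain ⟨q, hq⟩ := q
  obtain ⟨a, rfl⟩ := hbp
  obtain ⟨c, rfl⟩ := hbq
  have hp' : G.Adj b a := hp
  have hq' : G.Adj b c := hq
  refine ⟨a, b, c, hp'.symm, hq', fun h => hne (by subst h; rfl), ?_⟩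
  have he' : G.lineGraph.Adj ⟨s(b, a), hp'⟩ ⟨s(b, c), hq'⟩ := he
  have h1 := ndeg_lineGraph he'
  have h2 := ndeg_lineGraph hp'
  have h3 := ndeg_lineGraph hq'
  change ndeg G.lineGraph.lineGraph ⟨s(⟨s(b, a), hp'⟩, ⟨s(b, c), hq'⟩), he'⟩ + 6 = _
  omega

/-! ### Components containing a vertex of degree three. -/

/-- Claw-freeness makes two neighbours `a`, `c` of `b` adjacent, so both have degree at least two.
The bound `10` on the path `a b c` then forces `deg b = 3` and `deg a = deg c = 2`, and the path `a
b d` gives `deg d ≤ 2`. -/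
theorem exists_neighbors_of_three_le_ndeg {V : Type*} [Finite V] {N : SimpleGraph V}
    (hclaw : ClawFree N)
    (hdeg : ∀ a b c, N.Adj a b → N.Adj b c → a ≠ c →
      ndeg N a + 2 * ndeg N b + ndeg N c ≤ 10) {b : V} (hb : 3 ≤ ndeg N b) :
    ∃ a c d, a ≠ c ∧ a ≠ d ∧ c ≠ d ∧ (∀ y, N.Adj b y ↔ y = a ∨ y = c ∨ y = d) ∧
      (∀ y, N.Adj a y ↔ y = b ∨ y = c) ∧ (∀ y, N.Adj c y ↔ y = b ∨ y = a) ∧ ndeg N d ≤ 2 := by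
  have main : ∀ a c d, N.Adj b a → N.Adj b c → N.Adj b d → a ≠ c → a ≠ d → c ≠ d → N.Adj a c →
      ∃ a c d, a ≠ c ∧ a ≠ d ∧ c ≠ d ∧ (∀ y, N.Adj b y ↔ y = a ∨ y = c ∨ y = d) ∧
      (∀ y, N.Adj a y ↔ y = b ∨ y = c) ∧ (∀ y, N.Adj c y ↔ y = b ∨ y = a) ∧ ndeg N d ≤ 2 := by
    intro a c d ha hc hd hac had hcd hadj
    have sa : ({b, c} : Set V) ⊆ N.neighborSet a := by
      rintro y (rfl | rfl)
      exacts [ha.symm, hadj]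
    have sc : ({b, a} : Set V) ⊆ N.neighborSet c := by
      rintro y (rfl | rfl)
      exacts [hc.symm, hadj.symm]
    have sb : ({a, c, d} : Set V) ⊆ N.neighborSet b := by
      rintro y (rfl | rfl | rfl)
      exacts [ha, hc, hd]
    have ca : ({b, c} : Set V).ncard = 2 := Set.ncard_pair hc.ne
    have cc : ({b, a} : Set V).ncard = 2 := Set.ncard_pair ha.ne
    have cb : ({a, c, d} : Set V).ncard = 3 := Set.ncard_eq_three.2 ⟨a, c, d, hac, had, hcd, rfl⟩
    have la := Set.ncard_le_ncard sa (Set.toFinite _)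
    have lc := Set.ncard_le_ncard sc (Set.toFinite _)
    have d1 := hdeg a b c ha.symm hc hac
    have d2 := hdeg a b d ha.symm hd had
    simp only [ndeg] at d1 d2 hb
    have ea := Set.eq_of_subset_of_ncard_le sa (by omega) (Set.toFinite _)
    have ec := Set.eq_of_subset_of_ncard_le sc (by omega) (Set.toFinite _)
    have eb := Set.eq_of_subset_of_ncard_le sb (by omega) (Set.toFinite _)
    refine ⟨a, c, d, hac, had, hcd, fun y => ?_, fun y => ?_, fun y => ?_, ?_⟩
    · rw [← mem_neighborSet, ← eb]
      rfl
    · rw [← mem_neighborSet, ← ea]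
      rfl
    · rw [← mem_neighborSet, ← ec]
      rfl
    · rw [ndeg]
      omega
  obtain ⟨s, hs, hs3⟩ := Set.exists_subset_card_eq hb
  obtain ⟨p, q, r, hpq, hpr, hqr, rfl⟩ := Set.ncard_eq_three.1 hs3
  have hp : N.Adj b p := hs (by simp)
  have hq : N.Adj b q := hs (by simp)
  have hr : N.Adj b r := hs (by simp)
  rcases hclaw b p q r hp hq hr hpq hpr hqr with h | h | h
  · exact main p q r hp hq hr hpq hpr hqr h
  · exact main p r q hp hr hq hpr hpq hqr.symm h
  · exact main q r p hq hr hp hqr hpq.symm hpr.symm h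

/-- The path is a function on `ℕ`, of which only the values up to `n` matter, so that it can be
lengthened without changing its type. -/
theorem isComponentEmbedding_T {V : Type*} {N : SimpleGraph V} {k n : ℕ} (v : ℕ → V)
    (l : Fin k → Fin 2 → V) (hv : ∀ i ≤ n, ∀ j ≤ n, v i = v j → i = j)
    (hl : ∀ p t q s, l p t = l q s → p = q ∧ t = s) (hvl : ∀ i ≤ n, ∀ p t, v i ≠ l p t)
    (adj_v : ∀ i ≤ n, ∀ y, N.Adj (v i) y ↔ (∃ j ≤ n, (i + 1 = j ∨ j + 1 = i) ∧ v j = y) ∨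
      ∃ p t, i = (endIdx n p).val ∧ l p t = y)
    (adj_l : ∀ p t y, N.Adj (l p t) y ↔ v (endIdx n p) = y ∨ ∃ s, t ≠ s ∧ l p s = y) :
    IsComponentEmbedding (T k n) N (Sum.elim (fun i => v i) (fun p => l p.1 p.2)) := by
  refine ⟨?_, ?_⟩
  · rintro (i | ⟨p, t⟩) (j | ⟨q, s⟩) h
    · exact congrArg _ (Fin.ext (hv _ (by omega) _ (by omega) h))
    · exact absurd h (hvl _ (by omega) _ _)
    · exact absurd h.symm (hvl _ (by omega) _ _)
    · obtain ⟨rfl, rfl⟩ := hl _ _ _ _ h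
      rfl
  · rintro (i | ⟨p, t⟩) y
    · simp only [Sum.elim_inl, Sum.exists, Sum.elim_inr, T_adj_inl_inl, T_adj_inl_inr, Prod.exists]
      rw [adj_v i (by omega)]
      refine or_congr ?_ ?_
      · constructor
        · rintro ⟨j, hj, h⟩
          exact ⟨⟨j, by omega⟩, h⟩
        · rintro ⟨j, h⟩
          exact ⟨j, by omega, h⟩
      · simp only [Fin.ext_iff]
    · simp only [Sum.elim_inl, Sum.exists, Sum.elim_inr, T_adj_inr_inl, T_adj_inr_inr,
        Prod.exists]
      rw [adj_l]
      simp

/-- A triangle `a`, `c`, `v 0` in `N` and a path `v 0, …, v (m + 1)` starting from it, such that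
`N` has no further edges at these vertices, except possibly at `v (m + 1)`. -/
structure Lollipop {V : Type*} (N : SimpleGraph V) (v : ℕ → V) (a c : V) (m : ℕ) : Prop where
  inj : ∀ i ≤ m + 1, ∀ j ≤ m + 1, v i = v j → i = j
  ne_a : ∀ i ≤ m + 1, v i ≠ a
  ne_c : ∀ i ≤ m + 1, v i ≠ c
  adj_a : ∀ y, N.Adj a y ↔ y = v 0 ∨ y = c
  adj_c : ∀ y, N.Adj c y ↔ y = v 0 ∨ y = a
  adj_zero : ∀ y, N.Adj (v 0) y ↔ y = a ∨ y = c ∨ y = v 1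
  adj_succ : ∀ i < m, ∀ y, N.Adj (v (i + 1)) y ↔ y = v i ∨ y = v (i + 2)
  ndeg_one : ndeg N (v 1) ≤ 2

namespace Lollipop
variable {V : Type*} {N : SimpleGraph V} {v : ℕ → V} {a c : V} {m : ℕ}

theorem not_adj_a (h : Lollipop N v a c m) : ¬ N.Adj a (v (m + 1)) := by
  rw [h.adj_a]
  rintro (h' | h')
  · have := h.inj _ le_rfl _ (Nat.zero_le _) h'
    omega
  · exact h.ne_c _ le_rfl h'

theorem not_adj_c (h : Lollipop N v a c m) : ¬ N.Adj c (v (m + 1)) := by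
  rw [h.adj_c]
  rintro (h' | h')
  · have := h.inj _ le_rfl _ (Nat.zero_le _) h'
    omega
  · exact h.ne_a _ le_rfl h'

theorem eq_of_adj_last (h : Lollipop N v a c m) {j : ℕ} (hj : j ≤ m + 1)
    (hadj : N.Adj (v j) (v (m + 1))) : j = m := by
  rcases Nat.lt_or_ge m j with hlt | hge
  · obtain rfl : j = m + 1 := by omega
    exact absurd hadj (N.irrefl)
  rcases j with _ | j
  · rw [h.adj_zero] at hadj
    rcases hadj with h' | h' | h'
    · exact absurd h' (h.ne_a _ le_rfl)
    · exact absurd h' (h.ne_c _ le_rfl)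
    · have := h.inj _ le_rfl _ (by omega) h'
      omega
  · rw [h.adj_succ j (by omega)] at hadj
    rcases hadj with h' | h' <;> have := h.inj _ le_rfl _ (by omega) h' <;> omega

theorem adj_last (h : Lollipop N v a c m) : N.Adj (v m) (v (m + 1)) := by
  rcases m with _ | m
  · rw [h.adj_zero]
    simp
  · rw [h.adj_succ m (by omega)]
    simp

/-- A neighbour of the last vertex that is not its predecessor is new. -/
theorem new_of_adj (h : Lollipop N v a c m) {y : V} (hy : N.Adj (v (m + 1)) y)
    (hne : y ≠ v m) : y ≠ a ∧ y ≠ c ∧ ∀ i ≤ m + 1, v i ≠ y := by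
  refine ⟨?_, ?_, ?_⟩
  · rintro rfl
    exact h.not_adj_a hy.symm
  · rintro rfl
    exact h.not_adj_c hy.symm
  · rintro i hi rfl
    exact hne (by rw [h.eq_of_adj_last hi hy.symm])

/-- The last vertex and its predecessor have no common neighbour. -/
theorem not_adj_of_adj (h : Lollipop N v a c m) {y : V} (hy : N.Adj (v (m + 1)) y) :
    ¬ N.Adj (v m) y := by
  intro hadj
  obtain ⟨ya, yc, yv⟩ := h.new_of_adj hy hadj.ne.symm
  rcases m with _ | m
  · rw [h.adj_zero] at hadj
    rcases hadj with h' | h' | h'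
    · exact ya h'
    · exact yc h'
    · exact yv 1 le_rfl h'.symm
  · rw [h.adj_succ m (by omega)] at hadj
    rcases hadj with h' | h'
    · exact yv m (by omega) h'.symm
    · exact yv (m + 2) (by omega) h'.symm

theorem step_zero (v : ℕ → V) (m : ℕ) (y : V) :
    (∃ j ≤ m + 1, (0 + 1 = j ∨ j + 1 = 0) ∧ v j = y) ↔ y = v 1 := by
  constructor
  · rintro ⟨j, -, h | h, rfl⟩
    · rw [← h]
    · omega
  · rintro rfl
    exact ⟨1, by omega, by omega, rfl⟩

theorem step_succ (v : ℕ → V) {m i : ℕ} (hi : i < m) (y : V) :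
    (∃ j ≤ m + 1, (i + 1 + 1 = j ∨ j + 1 = i + 1) ∧ v j = y) ↔ y = v i ∨ y = v (i + 2) := by
  constructor
  · rintro ⟨j, -, h | h, rfl⟩
    · rw [← h]
      exact Or.inr rfl
    · obtain rfl : j = i := by omega
      exact Or.inl rfl
  · rintro (rfl | rfl)
    · exact ⟨i, by omega, by omega, rfl⟩
    · exact ⟨i + 2, by omega, by omega, rfl⟩

theorem step_last (v : ℕ → V) (m : ℕ) (y : V) :
    (∃ j ≤ m + 1, (m + 1 + 1 = j ∨ j + 1 = m + 1) ∧ v j = y) ↔ y = v m := by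
  constructor
  · rintro ⟨j, hj, h | h, rfl⟩
    · omega
    · obtain rfl : j = m := by omega
      rfl
  · rintro rfl
    exact ⟨m, by omega, by omega, rfl⟩

theorem component_one (h : Lollipop N v a c m) (hlast : ∀ y, N.Adj (v (m + 1)) y → y = v m) :
    ∃ f, IsComponentEmbedding (T 1 (m + 1)) N f := by
  have hac : a ≠ c := ((h.adj_a c).2 (Or.inr rfl)).ne
  refine ⟨_, isComponentEmbedding_T v (fun _ => ![a, c]) h.inj ?_ ?_ ?_ ?_⟩
  · intro p t q s
    fin_cases t <;> fin_cases s <;> simp [hac, hac.symm, Subsingleton.elim p q]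
  · intro i hi p t
    fin_cases t
    · exact h.ne_a i hi
    · exact h.ne_c i hi
  · intro i hi y
    simp only [Fin.exists_fin_two, Fin.exists_fin_one, endIdx_val]
    rcases i with _ | i
    · rw [step_zero, h.adj_zero]
      simp only [eq_comm (b := y)]
      simp
      tauto
    · rcases Nat.lt_or_ge i m with hlt | hge
      · rw [step_succ v hlt, h.adj_succ i hlt]
        simp
      · obtain rfl : i = m := by omega
        rw [step_last]
        simp only [Fin.val_zero, if_true, Nat.succ_ne_zero, false_and, or_false]
        refine ⟨hlast y, ?_⟩
        rintro rfl
        exact h.adj_last.symm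
  · intro p t y
    have he : (endIdx (m + 1) p).val = 0 := by simp [endIdx_val]
    rw [he]
    fin_cases t
    · simpa [Fin.exists_fin_two, eq_comm] using h.adj_a y
    · simpa [Fin.exists_fin_two, eq_comm] using h.adj_c y

theorem component_two (h : Lollipop N v a c m) {p q : V} (hpq : p ≠ q)
    (hp : ∀ y, N.Adj p y ↔ y = v (m + 1) ∨ y = q)
    (hq : ∀ y, N.Adj q y ↔ y = v (m + 1) ∨ y = p)
    (hpm : p ≠ v m) (hqm : q ≠ v m)
    (hlast : ∀ y, N.Adj (v (m + 1)) y ↔ y = p ∨ y = q ∨ y = v m) :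
    ∃ f, IsComponentEmbedding (T 2 (m + 1)) N f := by
  have hac : a ≠ c := ((h.adj_a c).2 (Or.inr rfl)).ne
  obtain ⟨pa, pc, pv⟩ := h.new_of_adj ((hlast p).2 (by simp)) hpm
  obtain ⟨qa, qc, qv⟩ := h.new_of_adj ((hlast q).2 (by simp)) hqm
  refine ⟨_, isComponentEmbedding_T v ![![a, c], ![p, q]] h.inj ?_ ?_ ?_ ?_⟩
  · intro i t j s
    fin_cases i <;> fin_cases j <;> fin_cases t <;> fin_cases s <;>
      simp [hac, hac.symm, pa, pa.symm, pc, pc.symm, qa, qa.symm, qc, qc.symm, hpq, hpq.symm]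
  · intro i hi j t
    fin_cases j <;> fin_cases t
    · exact h.ne_a i hi
    · exact h.ne_c i hi
    · exact pv i hi
    · exact qv i hi
  · intro i hi y
    simp only [Fin.exists_fin_two, endIdx_val]
    rcases i with _ | i
    · rw [step_zero, h.adj_zero]
      simp only [eq_comm (b := y)]
      simp
      tauto
    · rcases Nat.lt_or_ge i m with hlt | hge
      · rw [step_succ v hlt, h.adj_succ i hlt]
        have : i ≠ m := hlt.ne
        simp [this]
      · obtain rfl : i = m := by omega
        rw [step_last, hlast]
        simp only [eq_comm (b := y)]
        simp
        tauto
  · intro i t y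
    fin_cases i
    · have he : (endIdx (m + 1) (0 : Fin 2)).val = 0 := by simp [endIdx_val]
      change N.Adj (![a, c] t) y ↔ v (endIdx (m + 1) (0 : Fin 2)).val = y ∨
        ∃ s, t ≠ s ∧ ![a, c] s = y
      rw [he]
      fin_cases t
      · simpa [Fin.exists_fin_two, eq_comm] using h.adj_a y
      · simpa [Fin.exists_fin_two, eq_comm] using h.adj_c y
    · have he : (endIdx (m + 1) (1 : Fin 2)).val = m + 1 := by simp [endIdx_val]
      change N.Adj (![p, q] t) y ↔ v (endIdx (m + 1) (1 : Fin 2)).val = y ∨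
        ∃ s, t ≠ s ∧ ![p, q] s = y
      rw [he]
      fin_cases t
      · simpa [Fin.exists_fin_two, eq_comm] using hp y
      · simpa [Fin.exists_fin_two, eq_comm] using hq y

theorem extend (h : Lollipop N v a c m) {y : V} (hy : y ≠ v m)
    (hlast : ∀ z, N.Adj (v (m + 1)) z ↔ z = v m ∨ z = y) :
    Lollipop N (Function.update v (m + 2) y) a c (m + 1) := by
  obtain ⟨ya, yc, yv⟩ := h.new_of_adj ((hlast y).2 (by simp)) hy
  have hu : ∀ i ≤ m + 1, Function.update v (m + 2) y i = v i := fun i hi =>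
    Function.update_of_ne (by omega) _ _
  have hu' : Function.update v (m + 2) y (m + 2) = y := Function.update_self _ _ _
  refine ⟨?_, ?_, ?_, ?_, ?_, ?_, ?_, ?_⟩
  · intro i hi j hj
    rcases Nat.lt_or_ge (m + 1) i with hi' | hi' <;> rcases Nat.lt_or_ge (m + 1) j with hj' | hj'
    · intro _
      omega
    · obtain rfl : i = m + 2 := by omega
      rw [hu', hu j hj']
      exact fun h => absurd h.symm (yv j hj')
    · obtain rfl : j = m + 2 := by omega
      rw [hu', hu i hi']
      exact fun h => absurd h (yv i hi')
    · rw [hu i hi', hu j hj']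
      exact h.inj i hi' j hj'
  · intro i hi
    rcases Nat.lt_or_ge (m + 1) i with hi' | hi'
    · obtain rfl : i = m + 2 := by omega
      rwa [hu']
    · rw [hu i hi']
      exact h.ne_a i hi'
  · intro i hi
    rcases Nat.lt_or_ge (m + 1) i with hi' | hi'
    · obtain rfl : i = m + 2 := by omega
      rwa [hu']
    · rw [hu i hi']
      exact h.ne_c i hi'
  · rw [hu 0 (by omega)]
    exact h.adj_a
  · rw [hu 0 (by omega)]
    exact h.adj_c
  · rw [hu 0 (by omega), hu 1 (by omega)]
    exact h.adj_zero
  · intro i hi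
    rw [hu (i + 1) (by omega), hu i (by omega)]
    rcases Nat.lt_or_ge i m with hlt | hge
    · rw [hu (i + 2) (by omega)]
      exact h.adj_succ i hlt
    · obtain rfl : i = m := by omega
      rw [hu']
      exact hlast
  · rw [hu 1 (by omega)]
    exact h.ndeg_one

end Lollipop

/-- The local structure of claw-free graphs all of whose paths `a b c` satisfy
`deg a + 2 deg b + deg c ≤ 10` determines the component of a vertex of degree three. -/
theorem exists_isComponentEmbedding_T {V : Type*} [Finite V] {N : SimpleGraph V}
    (hclaw : ClawFree N)
    (hdeg : ∀ a b c, N.Adj a b → N.Adj b c → a ≠ c →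
      ndeg N a + 2 * ndeg N b + ndeg N c ≤ 10) {b : V} (hb : 3 ≤ ndeg N b) :
    ∃ k n, (k = 1 ∨ k = 2) ∧ k ≤ n ∧ ∃ f, IsComponentEmbedding (T k n) N f := by
  by_contra hcon
  -- The tip `v (m + 1)` decides: no further neighbour closes the component as `T 1 (m + 1)`,
  -- exactly one lengthens the path, and two or more make the tip the apex of a second triangle,
  -- which gives a `T 2`.
  have hstep : ∀ m v a c, Lollipop N v a c m → ∃ v, Lollipop N v a c (m + 1) := by
    intro m v a c h
    by_cases h1 : ∀ y, N.Adj (v (m + 1)) y → y = v m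
    · exact absurd ⟨1, m + 1, Or.inl rfl, by omega, h.component_one h1⟩ hcon
    push Not at h1
    obtain ⟨y, hy, hym⟩ := h1
    by_cases h2 : ∀ z, N.Adj (v (m + 1)) z → z = v m ∨ z = y
    · refine ⟨_, h.extend hym fun z => ⟨h2 z, ?_⟩⟩
      rintro (rfl | rfl)
      exacts [h.adj_last.symm, hy]
    push Not at h2
    obtain ⟨z, hz, hzm, hzy⟩ := h2
    have h3 : 3 ≤ ndeg N (v (m + 1)) := by
      have hsub : ({v m, y, z} : Set V) ⊆ N.neighborSet (v (m + 1)) := by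
        rintro w (rfl | rfl | rfl)
        exacts [h.adj_last.symm, hy, hz]
      have := Set.ncard_le_ncard hsub (Set.toFinite _)
      rwa [Set.ncard_eq_three.2 ⟨_, _, _, hym.symm, hzm.symm, hzy.symm, rfl⟩] at this
    obtain ⟨p, q, d, hpq, hpd, hqd, hlast, hp, hq, -⟩ :=
      exists_neighbors_of_three_le_ndeg hclaw hdeg h3
    have hpm : p ≠ v m := by
      rintro rfl
      exact h.not_adj_of_adj ((hlast q).2 (by simp)) ((hp q).2 (by simp))
    have hqm : q ≠ v m := by
      rintro rfl
      exact h.not_adj_of_adj ((hlast p).2 (by simp)) ((hq p).2 (by simp))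
    -- The predecessor `v m` shares no neighbour with the tip, so it is the neighbour outside the
    -- second triangle.
    have hdm : v m = d := by
      rcases (hlast (v m)).1 h.adj_last.symm with h' | h' | h'
      exacts [absurd h'.symm hpm, absurd h'.symm hqm, h']
    subst hdm
    -- For `m = 0` the tip is `v 1`, of degree at most two; this yields `k ≤ n` when `k = 2`.
    rcases m with _ | m
    · have := h.ndeg_one
      simp only [zero_add] at h3
      omega
    · exact absurd ⟨2, m + 2, Or.inr rfl, by omega, h.component_two hpq hp hq hpm hqm hlast⟩ hcon
  obtain ⟨a, c, d, hac, had, hcd, hb, ha, hc, hd⟩ :=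
    exists_neighbors_of_three_le_ndeg hclaw hdeg hb
  have hba := ((hb a).2 (by simp)).ne
  have hbc := ((hb c).2 (by simp)).ne
  have hbd := ((hb d).2 (by simp)).ne
  have base : Lollipop N (fun i => if i = 0 then b else d) a c 0 := by
    refine ⟨?_, ?_, ?_, by simpa using ha, by simpa using hc, by simpa using hb, ?_, by simpa⟩
    · intro i hi j hj
      interval_cases i <;> interval_cases j <;> simp [hbd, hbd.symm]
    · intro i hi
      interval_cases i <;> simp [hba, had.symm]
    · intro i hi
      interval_cases i <;> simp [hbc, hcd.symm]
    · omega
  have hall : ∀ m, ∃ v, Lollipop N v a c m := by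
    intro m
    induction m with
    | zero => exact ⟨_, base⟩
    | succ m ih =>
      obtain ⟨v, hv⟩ := ih
      exact hstep m v a c hv
  -- A walk that never closes would have more distinct vertices than `V`.
  obtain ⟨v, hv⟩ := hall (Nat.card V)
  have hinj : Function.Injective fun i : Fin (Nat.card V + 1) => v i := fun i j hij =>
    Fin.ext (hv.inj i (by omega) j (by omega) hij)
  have := Nat.card_le_card_of_injective _ hinj
  simp at this

/-! ### Parts (b) and (c). -/

theorem exists_isComponentEmbedding_T_of_iso {V X : Type*} [Finite X] {G : SimpleGraph V}
    {N : SimpleGraph X} (hclaw : ClawFree N) (e : G ≃g N.lineGraph.lineGraph)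
    (hle : ∀ x, ndeg G x ≤ 4) (hex : ∃ x, ndeg G x = 4) :
    ∃ k n, (k = 1 ∨ k = 2) ∧ k ≤ n ∧ ∃ f, IsComponentEmbedding (T k n) N f := by
  have hdeg : ∀ a b c, N.Adj a b → N.Adj b c → a ≠ c →
      ndeg N a + 2 * ndeg N b + ndeg N c ≤ 10 := by
    intro a b c hab hbc hac
    obtain ⟨x, hx⟩ := ndeg_lineGraph_lineGraph hab hbc hac
    have := hle (e.symm x)
    rw [ndeg_iso e.symm] at this
    omega
  obtain ⟨x, hx⟩ := hex
  obtain ⟨a, b, c, -, -, -, h⟩ := exists_path_of_lineGraph_lineGraph (e x)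
  rw [ndeg_iso e, hx] at h
  -- A vertex of degree four in `G` means a sum of `10`, while degrees at most two give at most `8`.
  have hb : ∃ b, 3 ≤ ndeg N b := by
    by_contra! hcon
    have := hcon a
    have := hcon b
    have := hcon c
    omega
  obtain ⟨b, hb⟩ := hb
  exact exists_isComponentEmbedding_T hclaw hdeg hb

/-- Taking line graphs twice turns the component `T k n` of `N` into a nonempty union of components
of `G`, hence into all of `G`. -/
theorem nonempty_iso_lineGraph_L {V X : Type*} {G : SimpleGraph V} {N : SimpleGraph X}
    (hconn : G.Connected) (e : G ≃g N.lineGraph.lineGraph) {k n : ℕ} (hk : k = 1 ∨ k = 2)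
    (hkn : k ≤ n) {f : Fin (n + 1) ⊕ (Fin k × Fin 2) → X} (hf : IsComponentEmbedding (T k n) N f) :
    Nonempty (G ≃g (L k n).lineGraph) := by
  obtain ⟨g, hg⟩ := hf.lineGraph
  obtain ⟨h, hh⟩ := hg.lineGraph
  obtain ⟨i⟩ := nonempty_iso_L (k := k) (by omega) (n := n) (by omega)
  have : Nonempty (L k n).edgeSet :=
    ⟨s(.inr (⟨0, by omega⟩, 0), .inr (⟨0, by omega⟩, 1)), (L_adj_inr_inr _ _).2 (by simp)⟩
  have : Nonempty (T k n).lineGraph.edgeSet := this.map i.lineGraph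
  obtain ⟨j⟩ := hh.nonempty_iso (e.connected_iff.1 hconn)
  exact ⟨(e.trans j.symm).trans i.lineGraph.symm⟩

/-- Line graphs of claw-free graphs have no component of the form `T k n`. -/
theorem not_isComponentEmbedding_T_lineGraph {X : Type*} {M : SimpleGraph X} (hM : ClawFree M)
    {k n : ℕ} (hk : 1 ≤ k) (hn : 1 ≤ n) {f : Fin (n + 1) ⊕ (Fin k × Fin 2) → M.edgeSet} :
    ¬ IsComponentEmbedding (T k n) M.lineGraph f := by
  intro hf
  let o : Fin k := ⟨0, hk⟩
  have ho : endIdx n o = 0 := by simp [endIdx, o]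
  obtain ⟨x, hx⟩ : ∃ x, x = f (.inr (o, 0)) := ⟨_, rfl⟩
  obtain ⟨y, hy⟩ : ∃ y, y = f (.inr (o, 1)) := ⟨_, rfl⟩
  obtain ⟨z, hz⟩ : ∃ z, z = f (.inl 0) := ⟨_, rfl⟩
  have hxy : M.lineGraph.Adj x y := by
    rw [hx, hy, hf.adj_iff, T_adj_inr_inr]
    simp
  have hxz : M.lineGraph.Adj x z := by
    rw [hx, hz, hf.adj_iff, T_adj_inr_inl, ho]
  have hyz : M.lineGraph.Adj y z := by
    rw [hy, hz, hf.adj_iff, T_adj_inr_inl, ho]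
  have nx : ∀ w, M.lineGraph.Adj x w → w = y ∨ w = z := by
    intro w hw
    rw [hx, hf.2] at hw
    obtain ⟨i | ⟨p, t⟩, hi, rfl⟩ := hw
    · rw [T_adj_inr_inl, ho] at hi
      exact Or.inr (by rw [hi, hz])
    · rw [T_adj_inr_inr] at hi
      obtain ⟨rfl, h2⟩ : o = p ∧ 0 ≠ t := hi
      exact Or.inl (by rw [hy, show t = 1 by omega])
  have ny : ∀ w, M.lineGraph.Adj y w → w = x ∨ w = z := by
    intro w hw
    rw [hy, hf.2] at hw
    obtain ⟨i | ⟨p, t⟩, hi, rfl⟩ := hw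
    · rw [T_adj_inr_inl, ho] at hi
      exact Or.inr (by rw [hi, hz])
    · rw [T_adj_inr_inr] at hi
      obtain ⟨rfl, h2⟩ : o = p ∧ 1 ≠ t := hi
      exact Or.inl (by rw [hx, show t = 0 by omega])
  -- The next path vertex, which exists because `1 ≤ n`, sees only `z` in the end triangle. Hence
  -- `x`, `y`, `z` are edges of `M` with a common vertex `p`.
  have hodd : OddTriangle M.lineGraph x y z := by
    refine ⟨hxy, hxz, hyz, f (.inl ⟨1, by omega⟩), ?_⟩
    rw [hx, hy, hz, hf.adj_iff, hf.adj_iff, hf.adj_iff, T_adj_inl_inr, T_adj_inl_inr,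
      T_adj_inl_inl, ho]
    simp [Fin.ext_iff]
  obtain ⟨p, hpx, hpy, hpz⟩ := hodd.exists_common
  have hne1 := hxy.ne
  have hne2 := hxz.ne
  have hne3 := hyz.ne
  clear hodd hx hy hz
  obtain ⟨x, hxM⟩ := x
  obtain ⟨y, hyM⟩ := y
  obtain ⟨z, hzM⟩ := z
  obtain ⟨x', rfl⟩ := hpx
  obtain ⟨y', rfl⟩ := hpy
  obtain ⟨z', rfl⟩ := hpz
  have hxM' : M.Adj p x' := hxM
  have hyM' : M.Adj p y' := hyM
  have hzM' : M.Adj p z' := hzM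
  have far : ∀ q r (h : M.Adj q r), M.Adj p q → M.Adj p r → ∀ s (hs : M.Adj p s),
      (⟨s(q, r), h⟩ : M.edgeSet) ≠ ⟨s(p, s), hs⟩ := by
    intro q r h hq hr s hs heq
    have := Subtype.ext_iff.1 heq
    simp only [Sym2.eq_iff] at this
    have := hq.ne
    have := hr.ne
    tauto
  have adj : ∀ q r (h : M.Adj q r), M.Adj p q → M.Adj p r → ∀ s (hs : M.Adj p s), s = q ∨ s = r →
      M.lineGraph.Adj ⟨s(p, s), hs⟩ ⟨s(q, r), h⟩ := by
    intro q r h hq hr s hs hsq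
    rw [lineGraph_adj_iff_exists]
    exact ⟨(far q r h hq hr s hs).symm, s, by simp, Sym2.mem_iff.2 hsq⟩
  -- An edge of `M` joining two of `x'`, `y'`, `z'` avoids `p`, so it lies outside the triangle; yet
  -- it is adjacent to `x` or `y`, whose neighbours all lie in the triangle.
  rcases hM p x' y' z' hxM' hyM' hzM' (fun h => hne1 (by subst h; rfl))
    (fun h => hne2 (by subst h; rfl)) (fun h => hne3 (by subst h; rfl)) with h | h | h
  · rcases nx _ (adj _ _ h hxM' hyM' _ hxM' (Or.inl rfl)) with h' | h'
    · exact far _ _ h hxM' hyM' _ hyM' h'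
    · exact far _ _ h hxM' hyM' _ hzM' h'
  · rcases nx _ (adj _ _ h hxM' hzM' _ hxM' (Or.inl rfl)) with h' | h'
    · exact far _ _ h hxM' hzM' _ hyM' h'
    · exact far _ _ h hxM' hzM' _ hzM' h'
  · rcases ny _ (adj _ _ h hyM' hzM' _ hyM' (Or.inl rfl)) with h' | h'
    · exact far _ _ h hyM' hzM' _ hxM' h'
    · exact far _ _ h hyM' hzM' _ hzM' h'

theorem finite_iterLineGraph {W : Type u} [Finite W] (H : SimpleGraph W) (n : ℕ) :
    Finite (iterLineGraph H n).1 := by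
  induction n with
  | zero => assumption
  | succ n ih =>
    change Finite (iterLineGraph H n).2.edgeSet
    infer_instance

theorem isIterLineGraph_three_lineGraph_L {V : Type u} {G : SimpleGraph V} {k n : ℕ}
    (hk : k = 1 ∨ k = 2) (hkn : k ≤ n) (h : Nonempty (G ≃g (L k n).lineGraph)) :
    IsIterLineGraph 3 G := by
  obtain ⟨e⟩ := h
  obtain ⟨i⟩ := nonempty_iso_L (k := k) (by omega) (n := n) (by omega)
  obtain ⟨j⟩ := nonempty_iso_T (k := k) (by omega) n
  let H : SimpleGraph (ULift.{u} (Fin (n + 1 + 1) ⊕ (Fin k × Fin 2))) :=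
    (S k (n + 1)).comap ULift.down
  let l : S k (n + 1) ≃g H := ⟨Equiv.ulift.symm, Iff.rfl⟩
  have e' : G ≃g H.lineGraph.lineGraph.lineGraph :=
    ((e.trans i.lineGraph).trans j.lineGraph.lineGraph).trans l.lineGraph.lineGraph.lineGraph
  exact ⟨_, inferInstance, H, ⟨e'⟩⟩

end IterLine

theorem mainTheorem5 {V : Type u} [Fintype V] (G : SimpleGraph V) [DecidableRel G.Adj]
    (hconn : G.Connected) (hdeg : G.maxDegree = 4)
    (hG3 : IsEmpty (G ≃g IterLine.G3)) (hG8 : IsEmpty (G ≃g IterLine.G8))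
    (hG9 : IsEmpty (G ≃g IterLine.G9)) (hH1 : IsEmpty (G ≃g IterLine.H1))
    (hH2 : IsEmpty (G ≃g IterLine.H2)) (hH3 : IsEmpty (G ≃g IterLine.H3)) :
    (IterLine.IsLineGraph G ↔
      (¬ IterLine.G1.IsIndContained G ∧ ¬ IterLine.G2.IsIndContained G ∧
        ¬ IterLine.G4.IsIndContained G ∧ ¬ IterLine.G5.IsIndContained G ∧
        ¬ IterLine.G6.IsIndContained G ∧ ¬ IterLine.G7.IsIndContained G ∧
        ¬ IterLine.ContainsPendant IterLine.G3 G)) ∧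
    (IterLine.IsIterLineGraph 3 G ↔
      ∃ k n : ℕ, (k = 1 ∨ k = 2) ∧ k ≤ n ∧ Nonempty (G ≃g (IterLine.L k n).lineGraph)) ∧
    (∀ n : ℕ, 4 ≤ n → ¬ IterLine.IsIterLineGraph n G) := by
  open IterLine in
  have : Nonempty V := hconn.nonempty
  have hndeg : ∀ x, ndeg G x = G.degree x := by
    intro x
    rw [ndeg, ← Nat.card_coe_set_eq, Nat.card_eq_fintype_card,
      SimpleGraph.card_neighborSet_eq_degree]
  have hle : ∀ x, ndeg G x ≤ 4 := fun x => by
    rw [hndeg, ← hdeg]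
    exact G.degree_le_maxDegree x
  obtain ⟨x, hx⟩ := G.exists_maximal_degree_vertex
  have hex : ∃ x, ndeg G x = 4 := ⟨x, by rw [hndeg, ← hx, hdeg]⟩
  obtain ⟨x', hx'⟩ := G.degree_pos_iff_exists_adj x |>.1 (by omega)
  have : Nontrivial V := ⟨⟨x, x', hx'.ne⟩⟩
  have hnb : ∀ y, ∃ z, G.Adj y z := fun y => by
    rw [← G.degree_pos_iff_exists_adj]
    exact hconn.preconnected.degree_pos_of_nontrivial y
  refine ⟨isLineGraph_iff_forbidden hconn hnb (degreeLeFour_of_maxDegree hdeg.le) hG3 hG8 hH1,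
    ⟨?_, ?_⟩, ?_⟩
  · rintro ⟨W, _, H, ⟨e⟩⟩
    have e' : G ≃g H.lineGraph.lineGraph.lineGraph := e
    obtain ⟨k, n, hk, hkn, f, hf⟩ :=
      exists_isComponentEmbedding_T_of_iso (clawFree_lineGraph H) e' hle hex
    exact ⟨k, n, hk, hkn, nonempty_iso_lineGraph_L hconn e' hk hkn hf⟩
  · rintro ⟨k, n, hk, hkn, h⟩
    exact isIterLineGraph_three_lineGraph_L hk hkn h
  · rintro n hn ⟨W, _, H, ⟨e⟩⟩
    obtain ⟨m, rfl⟩ := Nat.exists_eq_add_of_le' hn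
    have := finite_iterLineGraph H m
    -- Here `N` is the second line graph of `L^m(H)`; it is the line graph of `L(L^m(H))`, which is
    -- itself claw-free.
    have e' : G ≃g (iterLineGraph H m).2.lineGraph.lineGraph.lineGraph.lineGraph := e
    obtain ⟨k, n, hk, hkn, f, hf⟩ :=
      exists_isComponentEmbedding_T_of_iso (clawFree_lineGraph _) e' hle hex
    exact not_isComponentEmbedding_T_lineGraph (clawFree_lineGraph _) (by omega) (by omega) hf
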